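/- For every $n\ge 1$ let $X_{1},\dots,X_{n}$ (a triangular array, $X_i=X_{n,i}$) be independent real random variables whose laws $P_{n,1},\dots,P_{n,n}$ are absolutely continuous with respect to Lebesgue measure; the laws may differ from each other and may change with $n$. Put $$U_n^{\rm Ken}=\frac{1}{n(n-1)}\sum_{i\ne j}\mathbf 1(j<i)\,\mathbf 1(X_j>X_i),\qquad U_n^{\rm AP}=\frac{1}{n(n-1)}\sum_{i\ne j}\frac{n\,\mathbf 1(j<i)}{i-1}\,\mathbf 1(X_j>X_i)$$ (with $0/0:=0$); these are the rescaled Kendall's tau $(\tau^{\rm Ken}+1)/4$ and the rescaled average-precision correlation $(\tau^{\rm AP}+1)/2$. For real sequences write $a_n\gtrsim b_n$ (or $b_n\lesssim a_n$) if there is a constant $C$ with $|b_n|\le C|a_n|$ for all sufficiently large $n$, and $a_n\gnsim b_n$ if $a_n\gtrsim b_n$ holds but $a_n\lesssim b_n$ does not. Let $\delta_n\in(0,1)$ and $p_n\in(0,1)$, $n\ge 1$, be sequences such that for all sufficiently large $n$ and each $i\in\{1,\dots,n\}$ at least one of the following holds (which one may depend on $n$ and $i$): (i) $P\{P(X_j>X_i\mid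 X_i)-P(X_j>X_i)\in[\delta_n,1]\ \text{for all } j\in\{1,\dots,n\}\setminus\{i\}\}\ge p_n$; (ii) $P\{P(X_j>X_i\mid X_i)-P(X_j>X_i)\in[-1,-\delta_n]\ \text{for all } j\in\{1,\dots,n\}\setminus\{i\}\}\ge p_n$. Then: (a) if $\delta_n^3p_n\gnsim n^{-1/3}$, then ${\rm Var}(U_n^{\rm Ken})^{-1/2}\{U_n^{\rm Ken}-E(U_n^{\rm Ken})\}$ converges in distribution to $N(0,1)$ as $n\to\infty$; (b) if $\delta_n^3p_n\gnsim n^{-1/3}(\log n)^2$, then ${\rm Var}(U_n^{\rm AP})^{-1/2}\{U_n^{\rm AP}-E(U_n^{\rm AP})\}$ converges in distribution to $N(0,1)$ as $n\to\infty$. -/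

import Mathlib

open MeasureTheory ProbabilityTheory Filter Topology Asymptotics

noncomputable section

/-- The weighted U-statistic of degree two with weight `a` and kernel `h(x, y) = 𝟙(y > x)`:
`1 / (n (n - 1)) * ∑_{i ≠ j} a(i, j) 𝟙(x_j > x_i)`. -/
def weightedRankStat {n : ℕ} (a : Fin n → Fin n → ℝ) (x : Fin n → ℝ) : ℝ :=
  1 / ((n : ℝ) * ((n : ℝ) - 1)) *
    ∑ i : Fin n, ∑ j : Fin n, if j ≠ i then a i j * (if x i < x j then 1 else 0) else 0

/-- The (affinely rescaled) Kendall's tau `(τ^Ken + 1) / 4`: the weight is `𝟙(j < i)`. -/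
def kendallU {n : ℕ} (x : Fin n → ℝ) : ℝ :=
  weightedRankStat (fun i j => if j < i then 1 else 0) x

/-- The (affinely rescaled) average-precision correlation `(τ^AP + 1) / 2`: the weight is
`n 𝟙(j < i) / (i - 1)` for indices counted from `1`. An index `i : Fin n` is counted from `0`, so
`i - 1` becomes `(i : ℕ)`; it is positive whenever some `j < i` exists. -/
def apU {n : ℕ} (x : Fin n → ℝ) : ℝ :=
  weightedRankStat (fun i j => if j < i then (n : ℝ) / ((i : ℕ) : ℝ) else 0) x

/-- `a ⋧ b`: `a ≳ b` holds, that is `|b n| ≤ C |a n|` for some constant `C` and all large `n`, but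
`a ≲ b` does not. -/
def StrictlyGtrsim (a b : ℕ → ℝ) : Prop :=
  b =O[atTop] a ∧ ¬ a =O[atTop] b

/-- `P(X_j > X_i ∣ X_i) - P(X_j > X_i)` as a function on the probability space, where the first
term is the conditional probability given the σ-algebra generated by `X_i`. -/
def centeredCondProb {Ω : Type*} [MeasurableSpace Ω] (μ : Measure Ω) {n : ℕ}
    (X : Fin n → Ω → ℝ) (i j : Fin n) (ω : Ω) : ℝ :=
  (μ⟦{ω' | X i ω' < X j ω'} | MeasurableSpace.comap (X i) inferInstance⟧) ω
    - μ.real {ω' | X i ω' < X j ω'}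

/-- `Var(U_n)^{-1/2} (U_n - E U_n)` converges in distribution to `N(0, 1)`; the probability space
may change with `n`. -/
def AsymptoticallyNormal {Ω : ℕ → Type*} [∀ n, MeasurableSpace (Ω n)]
    (μ : ∀ n, Measure (Ω n)) [∀ n, IsProbabilityMeasure (μ n)] (U : ∀ n, Ω n → ℝ) : Prop :=
  TendstoInDistribution
    (fun n ω => (Var[U n; μ n]) ^ (-(1 / 2) : ℝ) * (U n ω - ∫ ω', U n ω' ∂(μ n)))
    atTop (id : ℝ → ℝ) μ (gaussianReal 0 1)

end

/-!
The Hoeffding decomposition splits `U - E U` into a sum of independent centred terms, one for each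
`X_k` (the Hájek projection), and a completely degenerate remainder that is uncorrelated with them.
Let `s` be the largest sum of the coefficients of a row and `s L` a bound on the column sums, so
that `L = 1` for Kendall's tau and `L = 1 + log n` for average precision. The remainder is a sum of
orthogonal terms and has variance `O(s² L)`, and each projection is `O(s L)`. Only the variance
needs a lower bound. For the last `⌈δ n / 16⌉` or so indices `k`, hardly any `i > k` is left, so the
projection on `X_k` is dominated by the contribution of the pairs `j < k`, whose deviations have a
common sign with probability at least `p`: it then exceeds `s δ / 4` in absolute value. Hence
`Var U ≥ c δ³ p n s²`, and `L² / n = o(δ³ p)` makes both the remainder and the largest projection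
negligible compared with the standard deviation. Replacing the characteristic functions of the
projections by Gaussian ones then gives the limit.
-/

/-! ### Characteristic functions -/

theorem norm_prod_sub_prod_le_sum {ι : Type*} (s : Finset ι) (a b : ι → ℂ)
    (ha : ∀ i ∈ s, ‖a i‖ ≤ 1) (hb : ∀ i ∈ s, ‖b i‖ ≤ 1) :
    ‖∏ i ∈ s, a i - ∏ i ∈ s, b i‖ ≤ ∑ i ∈ s, ‖a i - b i‖ := by
  classical
  induction s using Finset.induction_on with
  | empty => simp
  | insert i s hi ih =>
    rw [Finset.prod_insert hi, Finset.prod_insert hi, Finset.sum_insert hi]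
    have hprod : ‖∏ j ∈ s, a j‖ ≤ 1 := by
      rw [norm_prod]
      exact Finset.prod_le_one (fun _ _ => norm_nonneg _)
        fun j hj => ha j (Finset.mem_insert_of_mem hj)
    calc ‖a i * ∏ j ∈ s, a j - b i * ∏ j ∈ s, b j‖
        = ‖(a i - b i) * ∏ j ∈ s, a j + b i * (∏ j ∈ s, a j - ∏ j ∈ s, b j)‖ := by ring_nf
      _ ≤ ‖a i - b i‖ * ‖∏ j ∈ s, a j‖ + ‖b i‖ * ‖∏ j ∈ s, a j - ∏ j ∈ s, b j‖ := by
        simpa only [norm_mul] using norm_add_le ((a i - b i) * ∏ j ∈ s, a j)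
          (b i * (∏ j ∈ s, a j - ∏ j ∈ s, b j))
      _ ≤ ‖a i - b i‖ * 1 + 1 * ∑ j ∈ s, ‖a j - b j‖ := by
        gcongr
        · exact hb i (Finset.mem_insert_self _ _)
        · exact ih (fun j hj => ha j (Finset.mem_insert_of_mem hj))
            fun j hj => hb j (Finset.mem_insert_of_mem hj)
      _ = ‖a i - b i‖ + ∑ j ∈ s, ‖a j - b j‖ := by ring

theorem norm_cexp_mul_I_sub_taylor_two_le (x : ℝ) :
    ‖Complex.exp (x * Complex.I) - (1 + x * Complex.I - x ^ 2 / 2)‖ ≤ 3 * |x| ^ 3 := by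
  have hnorm : ‖(x * Complex.I : ℂ)‖ = |x| := by simp
  rcases le_total |x| 1 with hx | hx
  · have h := Complex.exp_bound (x := x * Complex.I) (by rwa [hnorm]) (n := 3) (by norm_num)
    have htaylor : ∑ m ∈ Finset.range 3, (x * Complex.I : ℂ) ^ m / (m.factorial : ℂ)
        = 1 + x * Complex.I - x ^ 2 / 2 := by
      simp [Finset.sum_range_succ, Nat.factorial, mul_pow]
      ring
    rw [htaylor, hnorm] at h
    refine h.trans ?_
    rw [mul_comm (3 : ℝ)]
    gcongr
    norm_num [Nat.factorial]
  · have hexp : ‖Complex.exp (x * Complex.I) - 1‖ ≤ |x| := by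
      rw [mul_comm]
      exact Real.norm_exp_I_mul_ofReal_sub_one_le
    have hsq : ‖(x ^ 2 / 2 : ℂ)‖ = |x| ^ 2 / 2 := by simp
    calc ‖Complex.exp (x * Complex.I) - (1 + x * Complex.I - x ^ 2 / 2)‖
        = ‖(Complex.exp (x * Complex.I) - 1) - x * Complex.I + x ^ 2 / 2‖ := by ring_nf
      _ ≤ |x| + |x| + |x| ^ 2 / 2 := by
        refine (norm_add_le _ _).trans ?_
        rw [hsq]
        gcongr
        refine (norm_sub_le _ _).trans ?_
        rw [hnorm]
        gcongr
      _ ≤ 3 * |x| ^ 3 := by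
        have h₁ : |x| ≤ |x| ^ 3 := le_self_pow₀ hx (by norm_num)
        have h₂ : |x| ^ 2 ≤ |x| ^ 3 := pow_le_pow_right₀ hx (by norm_num)
        have : 0 ≤ |x| ^ 3 := by positivity
        linarith

theorem abs_exp_neg_sub_one_sub_le {x : ℝ} (hx : 0 ≤ x) :
    |Real.exp (-x) - (1 - x)| ≤ x ^ 2 := by
  have hlower := Real.add_one_le_exp (-x)
  rw [abs_of_nonneg (by linarith)]
  rcases le_total x 1 with h | h
  · have := Real.abs_exp_sub_one_sub_id_le (x := -x) (by rwa [abs_neg, abs_of_nonneg hx])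
    linarith [le_abs_self (Real.exp (-x) - 1 - -x), neg_sq x]
  · nlinarith [Real.exp_le_one_iff.2 (neg_nonpos.2 hx)]

theorem abs_exp_neg_sub_exp_neg_le {x y : ℝ} (hx : 0 ≤ x) (hy : 0 ≤ y) :
    |Real.exp (-x) - Real.exp (-y)| ≤ |x - y| := by
  wlog h : x ≤ y generalizing x y
  · rw [abs_sub_comm, abs_sub_comm x]
    exact this hy hx (le_of_not_ge h)
  have hexp : Real.exp (-y) ≤ Real.exp (-x) := Real.exp_le_exp.2 (by linarith)
  rw [abs_of_nonneg (sub_nonneg.2 hexp), abs_of_nonpos (sub_nonpos.2 h)]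
  have hfactor : Real.exp (-x) - Real.exp (-y) = Real.exp (-x) * (1 - Real.exp (-(y - x))) := by
    rw [mul_sub, ← Real.exp_add]
    ring_nf
  rw [hfactor]
  nlinarith [Real.exp_le_one_iff.2 (neg_nonpos.2 hx), Real.exp_pos (-x),
    Real.add_one_le_exp (-(y - x)), Real.exp_le_one_iff.2 (by linarith : -(y - x) ≤ 0)]

section CharFun

variable {ν : Measure ℝ} [IsProbabilityMeasure ν]

theorem norm_charFun_sub_taylor_two_le (hν : MemLp id 3 ν) (hmean : ∫ x, x ∂ν = 0) (t : ℝ) :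
    ‖charFun ν t - (1 - t ^ 2 / 2 * ∫ x, x ^ 2 ∂ν : ℝ)‖ ≤ 3 * |t| ^ 3 * ∫ x, |x| ^ 3 ∂ν := by
  have hint₁ : Integrable (fun x : ℝ => x) ν := hν.integrable (by norm_num)
  have hint₂ : Integrable (fun x : ℝ => x ^ 2) ν :=
    (hν.mono_exponent (by norm_num : (2 : ENNReal) ≤ 3)).integrable_sq
  have hint₃ : Integrable (fun x : ℝ => |x| ^ 3) ν := hν.integrable_norm_pow (by norm_num)
  have hexp : Integrable (fun x : ℝ => Complex.exp ((t * x : ℝ) * Complex.I)) ν :=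
    .of_bound (by fun_prop) 1 (ae_of_all _ fun x => (Complex.norm_exp_ofReal_mul_I _).le)
  have hlin : Integrable (fun x : ℝ => 1 + ((t * x : ℝ) : ℂ) * Complex.I) ν :=
    (integrable_const _).add ((hint₁.const_mul t).ofReal.mul_const _)
  have hsq : Integrable (fun x : ℝ => ((t ^ 2 / 2 * x ^ 2 : ℝ) : ℂ)) ν :=
    (hint₂.const_mul _).ofReal
  have htaylor : charFun ν t - (1 - t ^ 2 / 2 * ∫ x, x ^ 2 ∂ν : ℝ)
      = ∫ x, (Complex.exp ((t * x : ℝ) * Complex.I)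
        - (1 + ((t * x : ℝ) : ℂ) * Complex.I - ((t ^ 2 / 2 * x ^ 2 : ℝ) : ℂ))) ∂ν := by
    rw [integral_sub hexp (by exact hlin.sub hsq), integral_sub hlin hsq,
      integral_add (integrable_const _) ((hint₁.const_mul t).ofReal.mul_const _),
      integral_mul_const, integral_complex_ofReal, integral_complex_ofReal, integral_const_mul,
      integral_const_mul, hmean, charFun_apply_real]
    simp
  rw [htaylor, ← integral_const_mul]
  refine norm_integral_le_of_norm_le (hint₃.const_mul _) (ae_of_all _ fun x => ?_)
  have hsq_eq : ((t ^ 2 / 2 * x ^ 2 : ℝ) : ℂ) = ((t * x : ℝ) : ℂ) ^ 2 / 2 := by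
    push_cast
    ring
  rw [hsq_eq]
  simpa only [abs_mul, mul_pow, mul_assoc] using norm_cexp_mul_I_sub_taylor_two_le (t * x)

theorem norm_charFun_sub_cexp_le {ε : ℝ} (hε : ∀ᵐ x ∂ν, |x| ≤ ε) (hmean : ∫ x, x ∂ν = 0)
    (t : ℝ) :
    ‖charFun ν t - (Real.exp (-(t ^ 2 / 2 * ∫ x, x ^ 2 ∂ν)) : ℝ)‖
      ≤ (3 * |t| ^ 3 * ε + t ^ 4 * ε ^ 2) * ∫ x, x ^ 2 ∂ν := by
  have hLp : ∀ q, MemLp id q ν := fun q => .of_bound (by fun_prop) ε hε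
  have hint₂ : Integrable (fun x : ℝ => x ^ 2) ν := (hLp 2).integrable_sq
  set v := ∫ x, x ^ 2 ∂ν with hv
  have : 0 ≤ v := integral_nonneg fun x => sq_nonneg x
  have hcube : ∫ x, |x| ^ 3 ∂ν ≤ ε * v := by
    rw [hv, ← integral_const_mul]
    refine integral_mono_ae ((hLp 3).integrable_norm_pow (by norm_num)) (hint₂.const_mul _) ?_
    filter_upwards [hε] with x hx
    rw [pow_succ, sq_abs, mul_comm]
    gcongr
  have hv_le : v ≤ ε ^ 2 := by
    have hsq : ∀ᵐ x ∂ν, x ^ 2 ≤ ε ^ 2 := hε.mono fun x hx => sq_abs x ▸ by gcongr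
    simpa using integral_mono_ae hint₂ (integrable_const _) hsq
  calc ‖charFun ν t - (Real.exp (-(t ^ 2 / 2 * v)) : ℝ)‖
      ≤ ‖charFun ν t - (1 - t ^ 2 / 2 * v : ℝ)‖
        + ‖((1 - t ^ 2 / 2 * v : ℝ) : ℂ) - (Real.exp (-(t ^ 2 / 2 * v)) : ℝ)‖ :=
        norm_sub_le_norm_sub_add_norm_sub _ _ _
    _ ≤ 3 * |t| ^ 3 * (ε * v) + (t ^ 2 / 2 * v) ^ 2 := by
      gcongr
      · exact (norm_charFun_sub_taylor_two_le (hLp 3) hmean t).trans (by gcongr)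
      · rw [← Complex.ofReal_sub, Complex.norm_real, Real.norm_eq_abs, abs_sub_comm]
        exact abs_exp_neg_sub_one_sub_le (by positivity)
    _ ≤ (3 * |t| ^ 3 * ε + t ^ 4 * ε ^ 2) * v := by
      have : (t ^ 2 / 2 * v) ^ 2 ≤ t ^ 4 * (ε ^ 2 * v) := by
        calc (t ^ 2 / 2 * v) ^ 2 = t ^ 4 * (1 / 4 * (v * v)) := by ring
          _ ≤ t ^ 4 * (1 * (ε ^ 2 * v)) := by gcongr; norm_num
          _ = t ^ 4 * (ε ^ 2 * v) := by ring
      linarith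

end CharFun

section CharFunMap

variable {Ω : Type*} [MeasurableSpace Ω] {μ : Measure Ω}

theorem charFun_map_rpow_neg_half_mul {Z : Ω → ℝ} {V : ℝ} (hV : 0 ≤ V) (hZ : AEMeasurable Z μ)
    (t : ℝ) :
    charFun (μ.map fun ω => V ^ (-(1 / 2) : ℝ) * Z ω) t = charFun (μ.map Z) ((√V)⁻¹ * t) := by
  rw [Real.rpow_neg hV, ← Real.sqrt_eq_rpow, ← charFun_map_mul,
    AEMeasurable.map_map_of_aemeasurable (by fun_prop) hZ]
  rfl

variable [IsProbabilityMeasure μ]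

theorem norm_charFun_map_sum_sub_exp_le {ι : Type*} [Fintype ι] {Y : ι → Ω → ℝ}
    (hY : ∀ i, AEMeasurable (Y i) μ) (hindep : iIndepFun Y μ) {ε : ℝ}
    (hε : ∀ i, ∀ᵐ ω ∂μ, |Y i ω| ≤ ε) (hmean : ∀ i, ∫ ω, Y i ω ∂μ = 0) (t : ℝ) :
    ‖charFun (μ.map fun ω => ∑ i, Y i ω) t
        - (Real.exp (-(t ^ 2 / 2 * ∑ i, ∫ ω, Y i ω ^ 2 ∂μ)) : ℝ)‖
      ≤ (3 * |t| ^ 3 * ε + t ^ 4 * ε ^ 2) * ∑ i, ∫ ω, Y i ω ^ 2 ∂μ := by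
  have hprob : ∀ i, IsProbabilityMeasure (μ.map (Y i)) := fun i =>
    Measure.isProbabilityMeasure_map (hY i)
  have hsq : ∀ i, ∫ x, x ^ 2 ∂(μ.map (Y i)) = ∫ ω, Y i ω ^ 2 ∂μ := fun i =>
    integral_map (hY i) (by fun_prop)
  rw [hindep.charFun_map_fun_sum_eq_prod hY, Finset.mul_sum, Finset.mul_sum,
    ← Finset.sum_neg_distrib, Real.exp_sum, Complex.ofReal_prod, Finset.prod_apply]
  refine (norm_prod_sub_prod_le_sum _ _ _ (fun i _ => norm_charFun_le_one t)
    fun i _ => ?_).trans (Finset.sum_le_sum fun i _ => ?_)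
  · rw [Complex.norm_real, Real.norm_eq_abs, Real.abs_exp, Real.exp_le_one_iff, neg_nonpos]
    exact mul_nonneg (by positivity) (integral_nonneg fun ω => sq_nonneg _)
  · rw [← hsq i]
    exact norm_charFun_sub_cexp_le
      ((ae_map_iff (hY i) (measurableSet_le (by fun_prop) measurable_const)).2 (hε i))
      ((integral_map (hY i) (by fun_prop)).trans (hmean i)) t

theorem integral_abs_le_sqrt_integral_sq {R : Ω → ℝ} (hR : MemLp R 2 μ) :
    ∫ ω, |R ω| ∂μ ≤ √(∫ ω, R ω ^ 2 ∂μ) := by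
  have h := variance_nonneg |R| μ
  rw [variance_eq_sub hR.abs] at h
  exact Real.le_sqrt_of_sq_le (by simpa using h)

theorem norm_charFun_map_add_sub_le {S R : Ω → ℝ} (hS : AEMeasurable S μ) (hR : MemLp R 2 μ)
    (t : ℝ) :
    ‖charFun (μ.map fun ω => S ω + R ω) t - charFun (μ.map S) t‖
      ≤ |t| * √(∫ ω, R ω ^ 2 ∂μ) := by
  have hSR : AEMeasurable (fun ω => S ω + R ω) μ := hS.add hR.aemeasurable
  have hcharFun : ∀ {Z : Ω → ℝ}, AEMeasurable Z μ →
      charFun (μ.map Z) t = ∫ ω, Complex.exp ((t * Z ω : ℝ) * Complex.I) ∂μ := fun hZ => by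
    simpa using charFun_apply_real t ▸ integral_map hZ (by fun_prop)
  have hint : ∀ {Z : Ω → ℝ}, AEMeasurable Z μ →
      Integrable (fun ω => Complex.exp ((t * Z ω : ℝ) * Complex.I)) μ := fun hZ =>
    .of_bound (by fun_prop) 1 (ae_of_all _ fun ω => (Complex.norm_exp_ofReal_mul_I _).le)
  rw [hcharFun hSR, hcharFun hS, ← integral_sub (hint hSR) (hint hS)]
  calc _ ≤ ∫ ω, |t| * |R ω| ∂μ := by
        refine norm_integral_le_of_norm_le ((hR.integrable (by norm_num)).abs.const_mul _)
          (ae_of_all _ fun ω => ?_)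
        have hfactor : Complex.exp ((t * (S ω + R ω) : ℝ) * Complex.I)
            - Complex.exp ((t * S ω : ℝ) * Complex.I)
            = Complex.exp ((t * S ω : ℝ) * Complex.I)
              * (Complex.exp (Complex.I * (t * R ω : ℝ)) - 1) := by
          rw [mul_sub, ← Complex.exp_add, mul_one]
          congr 2
          push_cast
          ring
        rw [hfactor, norm_mul, Complex.norm_exp_ofReal_mul_I, one_mul, ← abs_mul]
        exact Real.norm_exp_I_mul_ofReal_sub_one_le
    _ ≤ _ := by
      rw [integral_const_mul]
      gcongr
      exact integral_abs_le_sqrt_integral_sq hR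

end CharFunMap

/-! ### Hájek decompositions -/

/-- `W` minus its mean is the sum of independent centred terms `Y i` and of a centred remainder `R`
that is uncorrelated with each of them. The central limit theorem holds for `W` when every `Y i`
and `R` are negligible compared with the standard deviation of `W`. -/
structure IsHajekDecomposition {ι Ω : Type*} [Fintype ι] [MeasurableSpace Ω] (μ : Measure Ω)
    (W : Ω → ℝ) (Y : ι → Ω → ℝ) (R : Ω → ℝ) : Prop where
  memLp : ∀ i, MemLp (Y i) 2 μ
  indep : iIndepFun Y μ
  integral_eq_zero : ∀ i, ∫ ω, Y i ω ∂μ = 0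
  memLp_remainder : MemLp R 2 μ
  integral_remainder : ∫ ω, R ω ∂μ = 0
  integral_mul_remainder : ∀ i, ∫ ω, Y i ω * R ω ∂μ = 0
  sub_integral : ∀ ω, W ω - ∫ ω', W ω' ∂μ = ∑ i, Y i ω + R ω

namespace IsHajekDecomposition

variable {ι Ω : Type*} [Fintype ι] [MeasurableSpace Ω] {μ : Measure Ω}
  {W : Ω → ℝ} {Y : ι → Ω → ℝ} {R : Ω → ℝ}

theorem aemeasurable (h : IsHajekDecomposition μ W Y R) : AEMeasurable W μ := by
  have hY : ∀ i, AEMeasurable (Y i) μ := fun i => (h.memLp i).aemeasurable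
  have hR : AEMeasurable R μ := h.memLp_remainder.aemeasurable
  have hW : W = fun ω => ∑ i, Y i ω + R ω + ∫ ω', W ω' ∂μ :=
    funext fun ω => sub_eq_iff_eq_add.1 (h.sub_integral ω)
  rw [hW]
  fun_prop

variable [IsProbabilityMeasure μ]

theorem variance_eq (h : IsHajekDecomposition μ W Y R) :
    Var[W; μ] = ∑ i, ∫ ω, Y i ω ^ 2 ∂μ + ∫ ω, R ω ^ 2 ∂μ := by
  have hS : MemLp (∑ i, Y i) 2 μ := memLp_finsetSum' _ fun i _ => h.memLp i
  have hcov : cov[∑ i, Y i, R; μ] = 0 := by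
    rw [covariance_sum_left h.memLp h.memLp_remainder]
    refine Finset.sum_eq_zero fun i _ => ?_
    rw [covariance_eq_sub (h.memLp i) h.memLp_remainder, h.integral_remainder, mul_zero, sub_zero]
    exact h.integral_mul_remainder i
  calc Var[W; μ] = Var[fun ω => W ω - ∫ ω', W ω' ∂μ; μ] :=
        (variance_sub_const h.aemeasurable.aestronglyMeasurable _).symm
    _ = Var[∑ i, Y i + R; μ] := by
      congr 1 with ω
      simp [h.sub_integral ω]
    _ = Var[∑ i, Y i; μ] + Var[R; μ] := by
      rw [variance_add hS h.memLp_remainder, hcov, mul_zero, add_zero]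
    _ = ∑ i, ∫ ω, Y i ω ^ 2 ∂μ + ∫ ω, R ω ^ 2 ∂μ := by
      rw [IndepFun.variance_sum (fun i _ => h.memLp i) fun i _ j _ hij => h.indep.indepFun hij,
        variance_of_integral_eq_zero h.memLp_remainder.aemeasurable h.integral_remainder]
      congr 1
      exact Finset.sum_congr rfl fun i _ =>
        variance_of_integral_eq_zero (h.memLp i).aemeasurable (h.integral_eq_zero i)

theorem norm_charFun_sub_integral_sub_exp_le (h : IsHajekDecomposition μ W Y R) {ε : ℝ}
    (hε : ∀ i, ∀ᵐ ω ∂μ, |Y i ω| ≤ ε) (t : ℝ) :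
    ‖charFun (μ.map fun ω => W ω - ∫ ω', W ω' ∂μ) t
        - (Real.exp (-(t ^ 2 / 2 * Var[W; μ])) : ℝ)‖
      ≤ (3 * |t| ^ 3 * ε + t ^ 4 * ε ^ 2) * ∑ i, ∫ ω, Y i ω ^ 2 ∂μ
        + |t| * √(∫ ω, R ω ^ 2 ∂μ) + t ^ 2 / 2 * ∫ ω, R ω ^ 2 ∂μ := by
  have hY : ∀ i, AEMeasurable (Y i) μ := fun i => (h.memLp i).aemeasurable
  have : 0 ≤ ∑ i, ∫ ω, Y i ω ^ 2 ∂μ :=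
    Finset.sum_nonneg fun i _ => integral_nonneg fun ω => sq_nonneg _
  have : 0 ≤ ∫ ω, R ω ^ 2 ∂μ := integral_nonneg fun ω => sq_nonneg _
  have hremainder := norm_charFun_map_add_sub_le
    (Finset.aemeasurable_fun_sum Finset.univ fun i _ => hY i) h.memLp_remainder t
  have hsum := norm_charFun_map_sum_sub_exp_le hY h.indep hε h.integral_eq_zero t
  have hgauss : ‖((Real.exp (-(t ^ 2 / 2 * ∑ i, ∫ ω, Y i ω ^ 2 ∂μ)) : ℝ) : ℂ)
      - (Real.exp (-(t ^ 2 / 2 * Var[W; μ])) : ℝ)‖ ≤ t ^ 2 / 2 * ∫ ω, R ω ^ 2 ∂μ := by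
    rw [← Complex.ofReal_sub, Complex.norm_real, Real.norm_eq_abs, h.variance_eq]
    refine (abs_exp_neg_sub_exp_neg_le (by positivity) (by positivity)).trans_eq ?_
    rw [← mul_sub, sub_add_cancel_left, mul_neg, abs_neg, abs_of_nonneg (by positivity)]
  rw [funext h.sub_integral]
  refine (norm_sub_le_norm_sub_add_norm_sub _
    (charFun (μ.map fun ω => ∑ i, Y i ω) t) _).trans ?_
  have htriangle := norm_sub_le_norm_sub_add_norm_sub (charFun (μ.map fun ω => ∑ i, Y i ω) t)
    (Real.exp (-(t ^ 2 / 2 * ∑ i, ∫ ω, Y i ω ^ 2 ∂μ)) : ℝ)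
    (Real.exp (-(t ^ 2 / 2 * Var[W; μ])) : ℝ)
  linarith

theorem norm_charFun_standardized_sub_exp_le (h : IsHajekDecomposition μ W Y R) {r : ℝ}
    (hW : 0 < Var[W; μ]) (hY : ∀ i, ∀ᵐ ω ∂μ, Y i ω ^ 2 ≤ r * Var[W; μ])
    (hR : ∫ ω, R ω ^ 2 ∂μ ≤ r * Var[W; μ]) (t : ℝ) :
    ‖charFun (μ.map fun ω => Var[W; μ] ^ (-(1 / 2) : ℝ) * (W ω - ∫ ω', W ω' ∂μ)) t
        - (Real.exp (-(t ^ 2 / 2)) : ℝ)‖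
      ≤ (3 * |t| ^ 3 + |t|) * √r + (t ^ 4 + t ^ 2 / 2) * r := by
  set V := Var[W; μ] with hV
  have hr : 0 ≤ r := nonneg_of_mul_nonneg_left
    ((integral_nonneg fun ω => sq_nonneg (R ω)).trans hR) hW
  have hsum : ∑ i, ∫ ω, Y i ω ^ 2 ∂μ ≤ V := by
    rw [hV, h.variance_eq]
    exact le_add_of_nonneg_right (integral_nonneg fun ω => sq_nonneg _)
  have hsqrt : 0 < √V := Real.sqrt_pos.2 hW
  have hsq : √V ^ 2 = V := Real.sq_sqrt hW.le
  have hbound := h.norm_charFun_sub_integral_sub_exp_le (ε := √r * √V)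
    (fun i => (hY i).mono fun ω hω => by
      rw [← Real.sqrt_mul hr]
      exact Real.abs_le_sqrt hω) ((√V)⁻¹ * t)
  have hexp : ((√V)⁻¹ * t) ^ 2 / 2 * V = t ^ 2 / 2 := by
    rw [mul_pow, inv_pow, hsq]
    field_simp
  rw [charFun_map_rpow_neg_half_mul hW.le (h.aemeasurable.sub_const _)]
  rw [← hV, hexp] at hbound
  refine hbound.trans ?_
  rw [abs_mul, abs_of_pos (inv_pos.2 hsqrt)]
  calc _ ≤ (3 * ((√V)⁻¹ * |t|) ^ 3 * (√r * √V) + ((√V)⁻¹ * t) ^ 4 * (√r * √V) ^ 2) * √V ^ 2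
        + (√V)⁻¹ * |t| * (√r * √V) + ((√V)⁻¹ * t) ^ 2 / 2 * (√r * √V) ^ 2 := by
        rw [hsq]
        gcongr
        · exact (Real.sqrt_le_sqrt hR).trans_eq (Real.sqrt_mul hr V)
        · rwa [mul_pow, Real.sq_sqrt hr, hsq]
    _ = (3 * |t| ^ 3 + |t|) * √r + (t ^ 4 + t ^ 2 / 2) * √r ^ 2 := by
      field_simp
      ring
    _ = _ := by rw [Real.sq_sqrt hr]

end IsHajekDecomposition

theorem asymptoticallyNormal_of_isHajekDecomposition {Ω : ℕ → Type*}
    [∀ n, MeasurableSpace (Ω n)] {μ : ∀ n, Measure (Ω n)} [∀ n, IsProbabilityMeasure (μ n)]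
    {ι : ℕ → Type*} [∀ n, Fintype (ι n)] {W : ∀ n, Ω n → ℝ} {Y : ∀ n, ι n → Ω n → ℝ}
    {R : ∀ n, Ω n → ℝ} {r : ℕ → ℝ} (h : ∀ n, IsHajekDecomposition (μ n) (W n) (Y n) (R n))
    (hr : Tendsto r atTop (𝓝 0)) (hW : ∀ᶠ n in atTop, 0 < Var[W n; μ n])
    (hY : ∀ᶠ n in atTop, ∀ i, ∀ᵐ ω ∂(μ n), Y n i ω ^ 2 ≤ r n * Var[W n; μ n])
    (hR : ∀ᶠ n in atTop, ∫ ω, R n ω ^ 2 ∂(μ n) ≤ r n * Var[W n; μ n]) :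
    AsymptoticallyNormal μ W := by
  refine ⟨fun n => ((h n).aemeasurable.sub_const _).const_mul _, by fun_prop,
    ProbabilityMeasure.tendsto_iff_tendsto_charFun.2 fun t => ?_⟩
  simp only [ProbabilityMeasure.coe_mk, Measure.map_id]
  have hlimit : charFun (gaussianReal 0 1) t = (Real.exp (-(t ^ 2 / 2)) : ℝ) := by
    simp [charFun_gaussianReal]
  have hbound : Tendsto (fun n => (3 * |t| ^ 3 + |t|) * √(r n) + (t ^ 4 + t ^ 2 / 2) * r n) atTop
      (𝓝 0) := by
    simpa using (hr.sqrt.const_mul (3 * |t| ^ 3 + |t|)).add (hr.const_mul (t ^ 4 + t ^ 2 / 2))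
  rw [hlimit, tendsto_iff_norm_sub_tendsto_zero]
  refine squeeze_zero' (Eventually.of_forall fun n => norm_nonneg _) ?_ hbound
  filter_upwards [hW, hY, hR] with n hWn hYn hRn
  exact (h n).norm_charFun_standardized_sub_exp_le hWn hYn hRn t

/-! ### Product measures -/

theorem measurePreserving_update {ι : Type*} [Fintype ι] [DecidableEq ι] {E : ι → Type*}
    [∀ j, MeasurableSpace (E j)] (ν : ∀ j, Measure (E j)) [∀ j, IsProbabilityMeasure (ν j)]
    (i : ι) :
    MeasurePreserving (fun p : (∀ j, E j) × E i => Function.update p.1 i p.2)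
      ((Measure.pi ν).prod (ν i)) (Measure.pi ν) := by
  refine ⟨measurable_update', (Measure.pi_eq fun s hs => ?_).symm⟩
  have hpreimage : (fun p : (∀ j, E j) × E i => Function.update p.1 i p.2) ⁻¹' Set.univ.pi s
      = Set.univ.pi (Function.update s i Set.univ) ×ˢ s i := by
    ext p
    simp only [Set.mem_preimage, Set.mem_prod, Set.mem_univ_pi]
    rw [Function.forall_update_iff p.1 fun j y => y ∈ s j,
      Function.forall_update_iff s fun j t => p.1 j ∈ t]
    simp [and_comm]
  rw [Measure.map_apply measurable_update' (.univ_pi hs), hpreimage, Measure.prod_prod,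
    Measure.pi_pi, ← Finset.mul_prod_erase Finset.univ _ (Finset.mem_univ i),
    ← Finset.mul_prod_erase Finset.univ (fun j => ν j (s j)) (Finset.mem_univ i),
    Function.update_self, measure_univ, one_mul, mul_comm]
  congr 1
  refine Finset.prod_congr rfl fun j hj => ?_
  rw [Function.update_of_ne (Finset.ne_of_mem_erase hj)]

theorem integral_pi_eq_zero_of_integral_update_eq_zero {ι : Type*} [Fintype ι] [DecidableEq ι]
    {E : ι → Type*} [∀ j, MeasurableSpace (E j)] {ν : ∀ j, Measure (E j)}
    [∀ j, IsProbabilityMeasure (ν j)] {F : (∀ j, E j) → ℝ} (hF : Integrable F (Measure.pi ν))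
    (i : ι) (h : ∀ x, ∫ t, F (Function.update x i t) ∂(ν i) = 0) :
    ∫ x, F x ∂(Measure.pi ν) = 0 := by
  have hmp := measurePreserving_update ν i
  calc ∫ x, F x ∂(Measure.pi ν)
      = ∫ p, F (Function.update p.1 i p.2) ∂((Measure.pi ν).prod (ν i)) := by
        rw [← integral_map hmp.aemeasurable (by rw [hmp.map_eq]; exact hF.1), hmp.map_eq]
    _ = ∫ x, ∫ t, F (Function.update x i t) ∂(ν i) ∂(Measure.pi ν) :=
      integral_prod _ (hmp.integrable_comp_of_integrable hF)
    _ = 0 := by simp only [h, integral_zero]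

theorem AsymptoticallyNormal.comp_measurePreserving {Ω Ω' : ℕ → Type*}
    [∀ n, MeasurableSpace (Ω n)] [∀ n, MeasurableSpace (Ω' n)] {μ : ∀ n, Measure (Ω n)}
    [∀ n, IsProbabilityMeasure (μ n)] {ν : ∀ n, Measure (Ω' n)} [∀ n, IsProbabilityMeasure (ν n)]
    {U : ∀ n, Ω' n → ℝ} (hU : AsymptoticallyNormal ν U) (hUm : ∀ n, Measurable (U n))
    {X : ∀ n, Ω n → Ω' n} (hX : ∀ n, MeasurePreserving (X n) (μ n) (ν n)) :
    AsymptoticallyNormal μ fun n ω => U n (X n ω) := by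
  have hvar : ∀ n, Var[fun ω => U n (X n ω); μ n] = Var[U n; ν n] := fun n => by
    rw [← (hX n).map_eq, variance_map (hUm n).aemeasurable (hX n).aemeasurable]
    rfl
  have hmean : ∀ n, ∫ ω, U n (X n ω) ∂(μ n) = ∫ x, U n x ∂(ν n) := fun n => by
    rw [← (hX n).map_eq, integral_map (hX n).aemeasurable (hUm n).aestronglyMeasurable]
  have hZm : ∀ n, Measurable fun x =>
      Var[U n; ν n] ^ (-(1 / 2) : ℝ) * (U n x - ∫ x', U n x' ∂(ν n)) := fun n =>
    ((hUm n).sub_const _).const_mul _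
  have hlaw : ∀ n, (μ n).map (fun ω => Var[fun ω' => U n (X n ω'); μ n] ^ (-(1 / 2) : ℝ)
        * (U n (X n ω) - ∫ ω', U n (X n ω') ∂(μ n)))
      = (ν n).map fun x => Var[U n; ν n] ^ (-(1 / 2) : ℝ) * (U n x - ∫ x', U n x' ∂(ν n)) := by
    intro n
    rw [hvar, hmean, ← Function.comp_def (fun x =>
      Var[U n; ν n] ^ (-(1 / 2) : ℝ) * (U n x - ∫ x', U n x' ∂(ν n))),
      ← Measure.map_map (hZm n) (hX n).measurable, (hX n).map_eq]
  refine ⟨fun n => ?_, hU.aemeasurable_limit, hU.tendsto.congr fun n => Subtype.ext (hlaw n).symm⟩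
  rw [hvar, hmean]
  exact ((hZm n).comp (hX n).measurable).aemeasurable

theorem measurePreserving_pi_of_iIndepFun {ι Ω : Type*} [Fintype ι] [MeasurableSpace Ω]
    {μ : Measure Ω} {E : ι → Type*} [∀ i, MeasurableSpace (E i)] {X : ∀ i, Ω → E i}
    (hX : ∀ i, Measurable (X i)) (hindep : iIndepFun X μ) :
    MeasurePreserving (fun ω i => X i ω) μ (Measure.pi fun i => μ.map (X i)) := by
  have := hindep.isProbabilityMeasure
  exact ⟨measurable_pi_lambda _ hX,
    (iIndepFun_iff_map_fun_eq_pi_map fun i => (hX i).aemeasurable).1 hindep⟩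

/-! ### Hoeffding decomposition of weighted sums of a bounded kernel -/

/-- A jointly measurable kernel with values in `[-C, C]`. -/
structure IsBoundedKernel {E F : Type*} [MeasurableSpace E] [MeasurableSpace F]
    (h : E → F → ℝ) (C : ℝ) : Prop where
  measurable : Measurable (Function.uncurry h)
  abs_le : ∀ x y, |h x y| ≤ C

section Kernel

variable {E F : Type*} [MeasurableSpace E] [MeasurableSpace F]

/-- The mean `E h(X, Y)` for independent `X ∼ α` and `Y ∼ β`. -/
noncomputable def kernelMean (h : E → F → ℝ) (α : Measure E) (β : Measure F) : ℝ :=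
  ∫ x, ∫ y, h x y ∂β ∂α

/-- The Hájek projection `E h(x, Y) - E h(X, Y)` of the kernel on its first argument. The
projection on the second argument is that of `flip h`. -/
noncomputable def kernelProj (h : E → F → ℝ) (α : Measure E) (β : Measure F) (x : E) : ℝ :=
  ∫ y, h x y ∂β - kernelMean h α β

/-- The degenerate part of the kernel: what remains after removing the mean and both Hájek
projections. -/
noncomputable def degeneratePart (h : E → F → ℝ) (α : Measure E) (β : Measure F) (x : E) (y : F) :
    ℝ :=
  h x y - kernelMean h α β - kernelProj h α β x - kernelProj (flip h) β α y

namespace IsBoundedKernel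

variable {h : E → F → ℝ} {C : ℝ} {α : Measure E} {β : Measure F}

theorem flip (hh : IsBoundedKernel h C) : IsBoundedKernel (flip h) C :=
  ⟨hh.measurable.comp measurable_swap, fun y x => hh.abs_le x y⟩

theorem integrable_right [IsFiniteMeasure β] (hh : IsBoundedKernel h C) (x : E) :
    Integrable (h x) β :=
  .of_bound hh.measurable.of_uncurry_left.aestronglyMeasurable C
    (ae_of_all _ (hh.abs_le x))

theorem measurable_integral_right [SFinite β] (hh : IsBoundedKernel h C) :
    Measurable fun x => ∫ y, h x y ∂β :=
  hh.measurable.stronglyMeasurable.integral_prod_right.measurable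

theorem measurable_kernelProj [SFinite β] (hh : IsBoundedKernel h C) :
    Measurable (kernelProj h α β) :=
  hh.measurable_integral_right.sub_const _

theorem measurable_degeneratePart [SFinite α] [SFinite β] (hh : IsBoundedKernel h C) :
    Measurable fun p : E × F => degeneratePart h α β p.1 p.2 :=
  ((hh.measurable.sub_const _).sub (hh.measurable_kernelProj.comp measurable_fst)).sub
    (hh.flip.measurable_kernelProj.comp measurable_snd)

theorem abs_integral_right_le [IsProbabilityMeasure β] (hh : IsBoundedKernel h C) (x : E) :
    |∫ y, h x y ∂β| ≤ C := by
  simpa using norm_integral_le_of_norm_le_const (μ := β) (f := h x) (C := C)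
    (ae_of_all _ (hh.abs_le x))

variable [IsProbabilityMeasure α] [IsProbabilityMeasure β]

theorem abs_kernelMean_le (hh : IsBoundedKernel h C) : |kernelMean h α β| ≤ C := by
  simpa [kernelMean] using
    norm_integral_le_of_norm_le_const (μ := α) (f := fun x => ∫ y, h x y ∂β) (C := C)
      (ae_of_all _ hh.abs_integral_right_le)

theorem abs_kernelProj_le (hh : IsBoundedKernel h C) (x : E) : |kernelProj h α β x| ≤ 2 * C := by
  unfold kernelProj
  linarith [abs_sub (∫ y, h x y ∂β) (kernelMean h α β), hh.abs_integral_right_le (β := β) x,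
    hh.abs_kernelMean_le (α := α) (β := β)]

theorem abs_degeneratePart_le (hh : IsBoundedKernel h C) (x : E) (y : F) :
    |degeneratePart h α β x y| ≤ 6 * C := by
  unfold degeneratePart
  linarith [
    abs_sub (h x y - kernelMean h α β - kernelProj h α β x) (kernelProj (_root_.flip h) β α y),
    abs_sub (h x y - kernelMean h α β) (kernelProj h α β x), abs_sub (h x y) (kernelMean h α β),
    hh.abs_le x y, hh.abs_kernelMean_le (α := α) (β := β), hh.abs_kernelProj_le (α := α) (β := β) x,
    hh.flip.abs_kernelProj_le (α := β) (β := α) y]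

theorem kernelMean_flip (hh : IsBoundedKernel h C) :
    kernelMean (_root_.flip h) β α = kernelMean h α β :=
  (integral_integral_swap (.of_bound hh.measurable.aestronglyMeasurable C
    (ae_of_all _ fun p => hh.abs_le p.1 p.2))).symm

theorem integrable_kernelProj (hh : IsBoundedKernel h C) : Integrable (kernelProj h α β) α :=
  .of_bound hh.measurable_kernelProj.aestronglyMeasurable (2 * C)
    (ae_of_all _ hh.abs_kernelProj_le)

theorem integral_kernelProj (hh : IsBoundedKernel h C) : ∫ x, kernelProj h α β x ∂α = 0 := by
  have hint : Integrable (fun x => ∫ y, h x y ∂β) α :=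
    .of_bound hh.measurable_integral_right.aestronglyMeasurable C
      (ae_of_all _ hh.abs_integral_right_le)
  simp only [kernelProj]
  rw [integral_sub hint (integrable_const _)]
  simp [kernelMean]

theorem degeneratePart_flip (hh : IsBoundedKernel h C) (x : E) (y : F) :
    degeneratePart (_root_.flip h) β α y x = degeneratePart h α β x y := by
  have hflip : _root_.flip (_root_.flip h) = h := rfl
  have hval : _root_.flip h y x = h x y := rfl
  unfold degeneratePart
  rw [hh.kernelMean_flip, hflip, hval]
  ring

theorem integral_degeneratePart_right (hh : IsBoundedKernel h C) (x : E) :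
    ∫ y, degeneratePart h α β x y ∂β = 0 := by
  have hsplit : ∀ y, degeneratePart h α β x y
      = h x y - ∫ y', h x y' ∂β - kernelProj (_root_.flip h) β α y := fun y => by
    simp only [degeneratePart, kernelProj]
    ring
  simp only [hsplit]
  rw [integral_sub (by exact (hh.integrable_right x).sub (integrable_const _))
    hh.flip.integrable_kernelProj, integral_sub (hh.integrable_right x) (integrable_const _),
    hh.flip.integral_kernelProj]
  simp

theorem integral_degeneratePart_left (hh : IsBoundedKernel h C) (y : F) :
    ∫ x, degeneratePart h α β x y ∂α = 0 := by
  simpa only [hh.degeneratePart_flip] using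
    hh.flip.integral_degeneratePart_right (α := β) (β := α) y

end IsBoundedKernel

end Kernel

theorem integral_sum_sq_of_pairwise_orthogonal {κ Ω : Type*} [Fintype κ] [MeasurableSpace Ω]
    {μ : Measure Ω} {f : κ → Ω → ℝ} (hf : ∀ p, MemLp (f p) 2 μ)
    (horth : Pairwise fun p q => ∫ ω, f p ω * f q ω ∂μ = 0) :
    ∫ ω, (∑ p, f p ω) ^ 2 ∂μ = ∑ p, ∫ ω, f p ω ^ 2 ∂μ := by
  have hint : ∀ p q, Integrable (fun ω => f p ω * f q ω) μ := fun p q =>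
    (hf p).integrable_mul (hf q)
  simp only [sq, Finset.sum_mul_sum]
  rw [integral_finsetSum _ fun p _ => integrable_finsetSum _ fun q _ => hint p q]
  refine Finset.sum_congr rfl fun p _ => ?_
  rw [integral_finsetSum _ fun q _ => hint p q]
  exact Finset.sum_eq_single p (fun q _ hq => horth hq.symm) (by simp)

section PairSum

variable {ι E : Type*} [Fintype ι] [MeasurableSpace E]

/-- The statistic `∑ b i j h(x i, x j)` over all pairs of indices. -/
def pairSum (b : ι → ι → ℝ) (h : E → E → ℝ) (x : ι → E) : ℝ := ∑ i, ∑ j, b i j * h (x i) (x j)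

/-- The `k`-th summand of the Hájek projection of `pairSum b h`, collecting the projections on `x k`
of all the pairs that contain `k`. -/
noncomputable def hajekTerm (b : ι → ι → ℝ) (h : E → E → ℝ) (ν : ι → Measure E) (k : ι) (x : E) :
    ℝ :=
  ∑ j, b k j * kernelProj h (ν k) (ν j) x + ∑ i, b i k * kernelProj (flip h) (ν k) (ν i) x

/-- The completely degenerate part of the Hoeffding decomposition of `pairSum b h`. -/
noncomputable def hoeffdingRemainder (b : ι → ι → ℝ) (h : E → E → ℝ) (ν : ι → Measure E)
    (x : ι → E) : ℝ :=
  ∑ p : ι × ι, b p.1 p.2 * degeneratePart h (ν p.1) (ν p.2) (x p.1) (x p.2)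

theorem pairSum_eq_sum_kernelMean_add (b : ι → ι → ℝ) (h : E → E → ℝ) (ν : ι → Measure E)
    (x : ι → E) :
    pairSum b h x = ∑ i, ∑ j, b i j * kernelMean h (ν i) (ν j)
      + (∑ k, hajekTerm b h ν k (x k) + hoeffdingRemainder b h ν x) := by
  unfold pairSum hajekTerm hoeffdingRemainder
  rw [Finset.sum_add_distrib,
    Finset.sum_comm (f := fun k i => b i k * kernelProj (flip h) (ν k) (ν i) (x k)),
    Fintype.sum_prod_type]
  simp only [← Finset.sum_add_distrib]
  refine Finset.sum_congr rfl fun i _ => Finset.sum_congr rfl fun j _ => ?_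
  unfold degeneratePart
  ring

variable {b : ι → ι → ℝ} {h : E → E → ℝ} {C : ℝ} {ν : ι → Measure E}
  [∀ i, IsProbabilityMeasure (ν i)]

theorem measurable_pairSum (b : ι → ι → ℝ) (hh : IsBoundedKernel h C) :
    Measurable (pairSum b h) :=
  Finset.measurable_fun_sum _ fun i _ => Finset.measurable_fun_sum _ fun j _ =>
    have hm : Measurable fun x : ι → E => h (x i) (x j) :=
      hh.measurable.comp (f := fun x : ι → E => (x i, x j)) (by fun_prop)
    hm.const_mul _

theorem measurable_hajekTerm (hh : IsBoundedKernel h C) (k : ι) :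
    Measurable (hajekTerm b h ν k) :=
  (Finset.measurable_fun_sum _ fun _ _ => hh.measurable_kernelProj.const_mul _).add
    (Finset.measurable_fun_sum _ fun _ _ => hh.flip.measurable_kernelProj.const_mul _)

theorem abs_hajekTerm_le (hh : IsBoundedKernel h C) (k : ι) (x : E) :
    |hajekTerm b h ν k x| ≤ 2 * C * (∑ j, |b k j| + ∑ i, |b i k|) := by
  have hsum : ∀ a f : ι → ℝ, (∀ i, |f i| ≤ 2 * C) →
      |∑ i, a i * f i| ≤ 2 * C * ∑ i, |a i| := fun a f hf => by
    rw [Finset.mul_sum]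
    refine (Finset.abs_sum_le_sum_abs _ _).trans (Finset.sum_le_sum fun i _ => ?_)
    rw [abs_mul, mul_comm]
    gcongr
    exact hf i
  rw [mul_add]
  exact (abs_add_le _ _).trans (add_le_add (hsum _ _ fun _ => hh.abs_kernelProj_le x)
    (hsum _ _ fun _ => hh.flip.abs_kernelProj_le x))

theorem integral_hajekTerm (hh : IsBoundedKernel h C) (k : ι) :
    ∫ x, hajekTerm b h ν k x ∂(ν k) = 0 := by
  have hfst : ∀ j, Integrable (fun x => b k j * kernelProj h (ν k) (ν j) x) (ν k) := fun j =>
    hh.integrable_kernelProj.const_mul _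
  have hsnd : ∀ i, Integrable (fun x => b i k * kernelProj (flip h) (ν k) (ν i) x) (ν k) := fun i =>
    hh.flip.integrable_kernelProj.const_mul _
  simp only [hajekTerm]
  rw [integral_add (integrable_finsetSum _ fun j _ => hfst j)
    (integrable_finsetSum _ fun i _ => hsnd i), integral_finsetSum _ fun j _ => hfst j,
    integral_finsetSum _ fun i _ => hsnd i]
  simp [integral_const_mul, hh.integral_kernelProj, hh.flip.integral_kernelProj]

theorem memLp_hajekTerm (hh : IsBoundedKernel h C) (k : ι) :
    MemLp (hajekTerm b h ν k) 2 (ν k) :=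
  .of_bound (measurable_hajekTerm hh k).aestronglyMeasurable _ (ae_of_all _ (abs_hajekTerm_le hh k))

theorem memLp_degeneratePart_pi (hh : IsBoundedKernel h C) (i j : ι) (q : ENNReal) :
    MemLp (fun x : ι → E => degeneratePart h (ν i) (ν j) (x i) (x j)) q (Measure.pi ν) :=
  have hm : Measurable fun x : ι → E => degeneratePart h (ν i) (ν j) (x i) (x j) :=
    hh.measurable_degeneratePart.comp (f := fun x : ι → E => (x i, x j)) (by fun_prop)
  .of_bound hm.aestronglyMeasurable (6 * C) (ae_of_all _ fun _ => hh.abs_degeneratePart_le _ _)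

theorem memLp_hoeffdingRemainder (hh : IsBoundedKernel h C) :
    MemLp (hoeffdingRemainder b h ν) 2 (Measure.pi ν) :=
  memLp_finsetSum _ fun p _ => (memLp_degeneratePart_pi hh p.1 p.2 2).const_mul _

theorem integral_mul_degeneratePart_eq_zero (hh : IsBoundedKernel h C) {G : (ι → E) → ℝ}
    (hG : Integrable G (Measure.pi ν)) {s : Set ι} (hGs : DependsOn G s) {i j l : ι}
    (hij : i ≠ j) (hl : l = i ∨ l = j) (hls : l ∉ s) :
    ∫ x, G x * degeneratePart h (ν i) (ν j) (x i) (x j) ∂(Measure.pi ν) = 0 := by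
  classical
  have hint : Integrable (fun x => G x * degeneratePart h (ν i) (ν j) (x i) (x j))
      (Measure.pi ν) :=
    hG.mul_bdd (memLp_degeneratePart_pi hh i j 1).1
      (ae_of_all _ fun _ => hh.abs_degeneratePart_le _ _)
  refine integral_pi_eq_zero_of_integral_update_eq_zero hint l fun x => ?_
  have hG_update : ∀ t, G (Function.update x l t) = G x := fun t =>
    hGs fun k hk => Function.update_of_ne (ne_of_mem_of_not_mem hk hls) _ _
  simp only [hG_update]
  rw [integral_const_mul]
  rcases hl with rfl | rfl
  · simp only [Function.update_self, Function.update_of_ne hij.symm,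
      hh.integral_degeneratePart_left, mul_zero]
  · simp only [Function.update_self, Function.update_of_ne hij,
      hh.integral_degeneratePart_right, mul_zero]

theorem integral_mul_hoeffdingRemainder_eq_zero (hh : IsBoundedKernel h C)
    (hb : ∀ i, b i i = 0) {G : (ι → E) → ℝ} (hG : Integrable G (Measure.pi ν)) {s : Set ι}
    (hs : s.Subsingleton) (hGs : DependsOn G s) :
    ∫ x, G x * hoeffdingRemainder b h ν x ∂(Measure.pi ν) = 0 := by
  simp only [hoeffdingRemainder, Finset.mul_sum, mul_left_comm (G _)]
  rw [integral_finsetSum _ fun p _ => (hG.mul_bdd (memLp_degeneratePart_pi hh p.1 p.2 1).1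
    (ae_of_all _ fun _ => hh.abs_degeneratePart_le _ _)).const_mul _]
  refine Finset.sum_eq_zero fun ⟨i, j⟩ _ => ?_
  rw [integral_const_mul]
  rcases eq_or_ne i j with rfl | hij
  · rw [hb, zero_mul]
  obtain ⟨l, hl, hls⟩ : ∃ l, (l = i ∨ l = j) ∧ l ∉ s := by
    by_contra! hmem
    exact hij (hs (hmem i (.inl rfl)) (hmem j (.inr rfl)))
  rw [integral_mul_degeneratePart_eq_zero hh hG hGs hij hl hls, mul_zero]

theorem integral_degeneratePart_mul_degeneratePart (hh : IsBoundedKernel h C) {i j k l : ι}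
    (hij : i ≠ j) (hne : (i, j) ≠ (k, l)) (hswap : (i, j) ≠ (l, k)) :
    ∫ x, degeneratePart h (ν k) (ν l) (x k) (x l) * degeneratePart h (ν i) (ν j) (x i) (x j)
      ∂(Measure.pi ν) = 0 := by
  have hdep : DependsOn (fun x : ι → E => degeneratePart h (ν k) (ν l) (x k) (x l)) {k, l} :=
    fun x y hxy => by simp only [hxy k (by simp), hxy l (by simp)]
  obtain ⟨m, hm, hmkl⟩ : ∃ m, (m = i ∨ m = j) ∧ m ∉ ({k, l} : Set ι) := by
    by_contra! hmem
    have hi := hmem i (.inl rfl)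
    have hj := hmem j (.inr rfl)
    grind
  exact integral_mul_degeneratePart_eq_zero hh
    (memLp_one_iff_integrable.1 (memLp_degeneratePart_pi hh k l 1)) hdep hij hm hmkl

theorem pairwise_integral_mul_degeneratePart_eq_zero (hh : IsBoundedKernel h C)
    (hb : ∀ i j, b i j = 0 ∨ b j i = 0) :
    Pairwise fun p q : ι × ι => ∫ x : ι → E,
      b p.1 p.2 * degeneratePart h (ν p.1) (ν p.2) (x p.1) (x p.2)
        * (b q.1 q.2 * degeneratePart h (ν q.1) (ν q.2) (x q.1) (x q.2)) ∂(Measure.pi ν) = 0 := by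
  rintro ⟨k, l⟩ ⟨i, j⟩ hpq
  simp only [mul_mul_mul_comm]
  rw [integral_const_mul]
  by_cases hzero : b k l * b i j = 0
  · rw [hzero, zero_mul]
  obtain ⟨hkl, hij⟩ := mul_ne_zero_iff.1 hzero
  have hij_ne : i ≠ j := by
    rintro rfl
    exact hij ((hb i i).elim id id)
  have hswap : (i, j) ≠ (l, k) := fun heq => by
    obtain ⟨rfl, rfl⟩ := Prod.mk.inj heq
    exact (hb i j).elim hij hkl
  rw [integral_degeneratePart_mul_degeneratePart hh hij_ne hpq.symm hswap, mul_zero]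

theorem integral_degeneratePart_sq_le (hh : IsBoundedKernel h C) (i j : ι) :
    ∫ x : ι → E, degeneratePart h (ν i) (ν j) (x i) (x j) ^ 2 ∂(Measure.pi ν) ≤ 36 * C ^ 2 :=
  calc _ ≤ ∫ _ : ι → E, (6 * C) ^ 2 ∂(Measure.pi ν) :=
        integral_mono (memLp_degeneratePart_pi hh i j 2).integrable_sq (integrable_const _)
          fun _ => sq_le_sq.2 ((hh.abs_degeneratePart_le _ _).trans (le_abs_self _))
    _ = 36 * C ^ 2 := by
        rw [integral_const, probReal_univ, one_smul]
        ring

theorem integral_hoeffdingRemainder_sq_le (hh : IsBoundedKernel h C)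
    (hb : ∀ i j, b i j = 0 ∨ b j i = 0) :
    ∫ x, hoeffdingRemainder b h ν x ^ 2 ∂(Measure.pi ν) ≤ 36 * C ^ 2 * ∑ i, ∑ j, b i j ^ 2 := by
  simp only [hoeffdingRemainder]
  rw [integral_sum_sq_of_pairwise_orthogonal
    (f := fun (p : ι × ι) (x : ι → E) =>
      b p.1 p.2 * degeneratePart h (ν p.1) (ν p.2) (x p.1) (x p.2))
    (fun p => (memLp_degeneratePart_pi hh p.1 p.2 2).const_mul _)
    (pairwise_integral_mul_degeneratePart_eq_zero hh hb),
    ← Fintype.sum_prod_type' (f := fun i j => b i j ^ 2), Finset.mul_sum]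
  refine Finset.sum_le_sum fun p _ => ?_
  simp only [mul_pow]
  rw [integral_const_mul, mul_comm]
  exact mul_le_mul_of_nonneg_right (integral_degeneratePart_sq_le hh p.1 p.2) (sq_nonneg _)

theorem integral_hajekTerm_pi (hh : IsBoundedKernel h C) (k : ι) :
    ∫ x, hajekTerm b h ν k (x k) ∂(Measure.pi ν) = 0 :=
  (integral_comp_eval (measurable_hajekTerm hh k).aestronglyMeasurable).trans
    (integral_hajekTerm hh k)

theorem integral_hajekTerm_sq_pi (hh : IsBoundedKernel h C) (k : ι) :
    ∫ x, hajekTerm b h ν k (x k) ^ 2 ∂(Measure.pi ν) = ∫ x, hajekTerm b h ν k x ^ 2 ∂(ν k) := by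
  have hm : Measurable fun x => hajekTerm b h ν k x ^ 2 := (measurable_hajekTerm hh k).pow_const 2
  exact integral_comp_eval (μ := ν) (i := k) hm.aestronglyMeasurable

theorem isHajekDecomposition_pairSum (hh : IsBoundedKernel h C) (hb : ∀ i, b i i = 0) :
    IsHajekDecomposition (Measure.pi ν) (pairSum b h) (fun k x => hajekTerm b h ν k (x k))
      (hoeffdingRemainder b h ν) := by
  have hterm : ∀ k, MemLp (fun x : ι → E => hajekTerm b h ν k (x k)) 2 (Measure.pi ν) := fun k =>
    (memLp_hajekTerm hh k).comp_measurePreserving (measurePreserving_eval ν k)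
  have hrem := memLp_hoeffdingRemainder (b := b) (ν := ν) hh
  have hrem_mean : ∫ x, hoeffdingRemainder b h ν x ∂(Measure.pi ν) = 0 := by
    simpa using integral_mul_hoeffdingRemainder_eq_zero hh hb (integrable_const (1 : ℝ))
      Set.subsingleton_empty (dependsOn_const (1 : ℝ))
  have hmean : ∫ x, pairSum b h x ∂(Measure.pi ν) = ∑ i, ∑ j, b i j * kernelMean h (ν i) (ν j) := by
    have hint : ∀ k, Integrable (fun x : ι → E => hajekTerm b h ν k (x k)) (Measure.pi ν) :=
      fun k => (hterm k).integrable (by norm_num)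
    have hint_sum := integrable_finsetSum Finset.univ fun k _ => hint k
    have hint_rem := hrem.integrable (by norm_num)
    simp only [pairSum_eq_sum_kernelMean_add b h ν]
    rw [integral_add (integrable_const _) (by exact hint_sum.add hint_rem),
      integral_add hint_sum hint_rem, integral_finsetSum _ fun k _ => hint k, hrem_mean]
    simp [integral_hajekTerm_pi hh]
  refine ⟨hterm, iIndepFun_pi fun k => (measurable_hajekTerm hh k).aemeasurable,
    integral_hajekTerm_pi hh, hrem, hrem_mean, fun k => ?_, fun x => ?_⟩
  · exact integral_mul_hoeffdingRemainder_eq_zero hh hb ((hterm k).integrable (by norm_num))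
      Set.subsingleton_singleton (s := {k}) fun x y hxy => by simp only [hxy k rfl]
  · rw [hmean, pairSum_eq_sum_kernelMean_add b h ν x, add_sub_cancel_left]

end PairSum

/-! ### Conditional expectations given one of two independent variables -/

section Independent

variable {Ω E F : Type*} [MeasurableSpace Ω] [MeasurableSpace E] [MeasurableSpace F]
  {μ : Measure Ω} [IsProbabilityMeasure μ] {X : Ω → E} {Y : Ω → F} {h : E → F → ℝ} {C : ℝ}

theorem condDistrib_ae_eq_const_of_indepFun [StandardBorelSpace F] [Nonempty F]
    (hX : Measurable X) (hY : Measurable Y) (hXY : IndepFun X Y μ) :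
    condDistrib Y X μ =ᵐ[μ.map X] Kernel.const E (μ.map Y) := by
  have := Measure.isProbabilityMeasure_map (μ := μ) hY.aemeasurable
  refine condDistrib_ae_eq_of_measure_eq_compProd X hY.aemeasurable ?_
  rw [Measure.compProd_const]
  exact (indepFun_iff_map_prod_eq_prod_map_map hX.aemeasurable hY.aemeasurable).1 hXY

theorem IsBoundedKernel.integrable_comp (hh : IsBoundedKernel h C) (hX : Measurable X)
    (hY : Measurable Y) : Integrable (fun ω => h (X ω) (Y ω)) μ :=
  .of_bound (hh.measurable.comp (hX.prodMk hY)).aestronglyMeasurable C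
    (ae_of_all _ fun _ => hh.abs_le _ _)

theorem IsBoundedKernel.condExp_ae_eq_of_indepFun [StandardBorelSpace F] [Nonempty F]
    (hh : IsBoundedKernel h C) (hX : Measurable X) (hY : Measurable Y) (hXY : IndepFun X Y μ) :
    μ[fun ω => h (X ω) (Y ω) | MeasurableSpace.comap X inferInstance]
      =ᵐ[μ] fun ω => ∫ y, h (X ω) y ∂(μ.map Y) := by
  filter_upwards [condExp_prod_ae_eq_integral_condDistrib hX hY.aemeasurable
    hh.measurable.stronglyMeasurable (hh.integrable_comp hX hY),
    ae_of_ae_map hX.aemeasurable (condDistrib_ae_eq_const_of_indepFun hX hY hXY)]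
    with ω hcond hconst
  rw [hconst, Kernel.const_apply] at hcond
  exact hcond

theorem IsBoundedKernel.integral_comp_of_indepFun (hh : IsBoundedKernel h C) (hX : Measurable X)
    (hY : Measurable Y) (hXY : IndepFun X Y μ) :
    ∫ ω, h (X ω) (Y ω) ∂μ = kernelMean h (μ.map X) (μ.map Y) := by
  have := Measure.isProbabilityMeasure_map (μ := μ) hX.aemeasurable
  have := Measure.isProbabilityMeasure_map (μ := μ) hY.aemeasurable
  have hlaw := (indepFun_iff_map_prod_eq_prod_map_map hX.aemeasurable hY.aemeasurable).1 hXY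
  calc ∫ ω, h (X ω) (Y ω) ∂μ = ∫ p, Function.uncurry h p ∂(μ.map fun ω => (X ω, Y ω)) :=
        (integral_map (hX.prodMk hY).aemeasurable hh.measurable.aestronglyMeasurable).symm
    _ = kernelMean h (μ.map X) (μ.map Y) := by
        rw [hlaw]
        exact integral_prod _ (hh.integrable_comp measurable_fst measurable_snd)

end Independent

/-! ### The order kernel -/

/-- The kernel `𝟙(x < y)` of Kendall's tau and of average-precision correlation. -/
noncomputable def ltKernel (x y : ℝ) : ℝ := if x < y then 1 else 0

theorem isBoundedKernel_ltKernel : IsBoundedKernel ltKernel 1 where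
  measurable :=
    Measurable.ite (measurableSet_lt measurable_fst measurable_snd) measurable_const
      measurable_const
  abs_le x y := by
    unfold ltKernel
    split_ifs <;> simp

/-- The values `x` at which, for every `j < k`, the projection `P(X_j > x) - P(X_j > X_k)` is at
least `d` in absolute value, with the same sign for all `j`; here `ν` lists the laws. -/
def oneSidedDeviation {n : ℕ} (ν : Fin n → Measure ℝ) (d : ℝ) (k : Fin n) : Set ℝ :=
  {x | (∀ j < k, d ≤ kernelProj ltKernel (ν k) (ν j) x) ∨
    ∀ j < k, kernelProj ltKernel (ν k) (ν j) x ≤ -d}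

section CenteredCondProb

variable {Ω : Type*} [MeasurableSpace Ω] {μ : Measure Ω} [IsProbabilityMeasure μ] {n : ℕ}
  {X : Fin n → Ω → ℝ}

theorem centeredCondProb_ae_eq_kernelProj (hX : ∀ i, Measurable (X i)) (hindep : iIndepFun X μ)
    {i j : Fin n} (hij : i ≠ j) :
    centeredCondProb μ X i j
      =ᵐ[μ] fun ω => kernelProj ltKernel (μ.map (X i)) (μ.map (X j)) (X i ω) := by
  have hset : MeasurableSet {ω | X i ω < X j ω} := measurableSet_lt (hX i) (hX j)
  have hindicator : ({ω | X i ω < X j ω}.indicator fun _ => (1 : ℝ))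
      = fun ω => ltKernel (X i ω) (X j ω) := by
    ext ω
    simp [Set.indicator, ltKernel]
  have hmean : μ.real {ω | X i ω < X j ω} = kernelMean ltKernel (μ.map (X i)) (μ.map (X j)) := by
    rw [← isBoundedKernel_ltKernel.integral_comp_of_indepFun (hX i) (hX j) (hindep.indepFun hij),
      ← hindicator]
    exact (integral_indicator_one hset).symm
  filter_upwards [isBoundedKernel_ltKernel.condExp_ae_eq_of_indepFun (hX i) (hX j)
    (hindep.indepFun hij)] with ω hω
  rw [centeredCondProb, hindicator, hω, hmean, kernelProj]

theorem measurableSet_oneSidedDeviation {ν : Fin n → Measure ℝ} [∀ i, SFinite (ν i)] (d : ℝ)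
    (k : Fin n) : MeasurableSet (oneSidedDeviation ν d k) := by
  have hproj : ∀ j, Measurable (kernelProj ltKernel (ν k) (ν j)) := fun _ =>
    isBoundedKernel_ltKernel.measurable_kernelProj
  simp only [oneSidedDeviation, Set.ofPred_or, Set.ofPred_forall]
  exact .union (.iInter fun j => .iInter fun _ => measurableSet_le measurable_const (hproj j))
    (.iInter fun j => .iInter fun _ => measurableSet_le (hproj j) measurable_const)

theorem le_measureReal_oneSidedDeviation (hX : ∀ i, Measurable (X i)) (hindep : iIndepFun X μ)
    {k : Fin n} {d p : ℝ}
    (hdev : p ≤ μ.real {ω | ∀ j < k, d ≤ centeredCondProb μ X k j ω} ∨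
      p ≤ μ.real {ω | ∀ j < k, centeredCondProb μ X k j ω ≤ -d}) :
    p ≤ (μ.map (X k)).real (oneSidedDeviation (fun i => μ.map (X i)) d k) := by
  have hproj : ∀ᵐ ω ∂μ, ∀ j, j < k → centeredCondProb μ X k j ω
      = kernelProj ltKernel (μ.map (X k)) (μ.map (X j)) (X k ω) :=
    ae_all_iff.2 fun j => Filter.eventually_imp_distrib_left.2 fun hj =>
      centeredCondProb_ae_eq_kernelProj hX hindep hj.ne'
  rw [map_measureReal_apply (hX k) (measurableSet_oneSidedDeviation d k)]
  refine hdev.elim (fun h => h.trans ?_) fun h => h.trans ?_ <;>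
    refine ENNReal.toReal_mono (measure_ne_top _ _) (measure_mono_ae ?_) <;>
    filter_upwards [hproj] with ω hω hmem
  · exact .inl fun j hj => (hmem j hj).trans_eq (hω j hj)
  · exact .inr fun j hj => (hω j hj).ge.trans (hmem j hj)

end CenteredCondProb

/-! ### Lower triangular row weights -/

theorem mul_le_sum_of_le_last {n : ℕ} {f : Fin n → ℝ} {a c : ℝ} (ha : 0 ≤ a) (han : a < n)
    (hc : 0 ≤ c) (hf : ∀ k, 0 ≤ f k) (hlast : ∀ k : Fin n, (n : ℝ) - 1 - k ≤ a → c ≤ f k) :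
    a * c ≤ ∑ k, f k := by
  have hfloor : ⌊a⌋₊ < n := (Nat.floor_lt ha).2 han
  let first : Fin n := ⟨n - (⌊a⌋₊ + 1), by lia⟩
  have hcard : (Finset.Ici first).card = ⌊a⌋₊ + 1 := by
    simp only [Fin.card_Ici, first]
    lia
  calc a * c ≤ (⌊a⌋₊ + 1) * c := by gcongr; exact (Nat.lt_floor_add_one a).le
    _ = ∑ _k ∈ Finset.Ici first, c := by rw [Finset.sum_const, hcard]; simp
    _ ≤ ∑ k ∈ Finset.Ici first, f k := Finset.sum_le_sum fun k hk => hlast k <| by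
        have hle : n ≤ ⌊a⌋₊ + 1 + k := by
          have : n - (⌊a⌋₊ + 1) ≤ (k : ℕ) := Fin.le_def.1 (Finset.mem_Ici.1 hk)
          lia
        have hle' : (n : ℝ) ≤ ⌊a⌋₊ + 1 + k := by exact_mod_cast hle
        linarith [Nat.floor_le ha]
    _ ≤ ∑ k, f k := Finset.sum_le_univ_sum_of_nonneg hf

/-- The strictly lower triangular array of coefficients whose `i`-th row is constantly `w i`. -/
def lowerWeight {n : ℕ} (w : Fin n → ℝ) (i j : Fin n) : ℝ := if j < i then w i else 0

/-- Row weights of size `s`: the coefficients of `lowerWeight w` sum up to at most `s` in each row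
and to at least `s / 2` in the last rows, while the column sums are at most `s * L`. -/
structure IsRowWeight {n : ℕ} (w : Fin n → ℝ) (s L : ℝ) : Prop where
  size_nonneg : 0 ≤ s
  nonneg : ∀ i, 0 ≤ w i
  mul_le : ∀ i : Fin n, i * w i ≤ s
  le_mul : ∀ i : Fin n, (n : ℝ) / 2 ≤ i → s / 2 ≤ i * w i
  sum_le : ∑ i, w i ≤ s * L

section LowerWeight

variable {n : ℕ} {w : Fin n → ℝ}

theorem lowerWeight_self (w : Fin n → ℝ) (i : Fin n) : lowerWeight w i i = 0 :=
  if_neg (lt_irrefl i)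

theorem lowerWeight_eq_zero_or_eq_zero (w : Fin n → ℝ) (i j : Fin n) :
    lowerWeight w i j = 0 ∨ lowerWeight w j i = 0 :=
  (le_total i j).imp (fun h => if_neg h.not_gt) fun h => if_neg h.not_gt

theorem sum_lowerWeight_mul_row (w f : Fin n → ℝ) (k : Fin n) :
    ∑ j, lowerWeight w k j * f j = w k * ∑ j ∈ Finset.Iio k, f j := by
  simp only [lowerWeight, ite_mul, zero_mul, ← Finset.sum_filter, Finset.filter_gt_eq_Iio,
    Finset.mul_sum]

theorem sum_lowerWeight_mul_col (w f : Fin n → ℝ) (k : Fin n) :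
    ∑ i, lowerWeight w i k * f i = ∑ i ∈ Finset.Ioi k, w i * f i := by
  simp only [lowerWeight, ite_mul, zero_mul, ← Finset.sum_filter, Finset.filter_lt_eq_Ioi]

theorem sum_lowerWeight_row (w : Fin n → ℝ) (k : Fin n) :
    ∑ j, lowerWeight w k j = k * w k := by
  simpa [mul_comm] using sum_lowerWeight_mul_row w 1 k

namespace IsRowWeight

variable {s L : ℝ}

theorem lowerWeight_nonneg (hw : IsRowWeight w s L) (i j : Fin n) : 0 ≤ lowerWeight w i j :=
  ite_nonneg (hw.nonneg i) le_rfl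

theorem sum_abs_lowerWeight_le (hw : IsRowWeight w s L) (k : Fin n) :
    ∑ j, |lowerWeight w k j| + ∑ i, |lowerWeight w i k| ≤ s + s * L := by
  simp only [abs_of_nonneg (hw.lowerWeight_nonneg _ _)]
  refine add_le_add ((sum_lowerWeight_row w k).trans_le (hw.mul_le k))
    ((Finset.sum_le_sum fun i _ => ?_).trans hw.sum_le)
  unfold lowerWeight
  split_ifs
  exacts [le_rfl, hw.nonneg i]

theorem sum_lowerWeight_sq_le (hw : IsRowWeight w s L) :
    ∑ i, ∑ j, lowerWeight w i j ^ 2 ≤ s ^ 2 * L := by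
  have hrow : ∀ i, ∑ j, lowerWeight w i j ^ 2 = w i * (i * w i) := fun i => by
    rw [← sum_lowerWeight_row, Finset.mul_sum]
    refine Finset.sum_congr rfl fun j _ => ?_
    unfold lowerWeight
    split_ifs <;> ring
  calc ∑ i, ∑ j, lowerWeight w i j ^ 2 = ∑ i, w i * (i * w i) := by simp only [hrow]
    _ ≤ ∑ i, w i * s := Finset.sum_le_sum fun i _ =>
        mul_le_mul_of_nonneg_left (hw.mul_le i) (hw.nonneg i)
    _ = s * ∑ i, w i := by rw [← Finset.sum_mul, mul_comm]
    _ ≤ s * (s * L) := mul_le_mul_of_nonneg_left hw.sum_le hw.size_nonneg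
    _ = s ^ 2 * L := by ring

theorem abs_sum_col_le (hw : IsRowWeight w s L) {k : Fin n} (hk : (n : ℝ) / 2 ≤ k) {f : Fin n → ℝ}
    {C : ℝ} (hf : ∀ i, |f i| ≤ C) :
    |∑ i, lowerWeight w i k * f i| ≤ ((n : ℝ) - 1 - k) * (2 * s / n * C) := by
  have hn : (0 : ℝ) < n := by exact_mod_cast k.pos
  have hterm : ∀ i ∈ Finset.Ioi k, |w i * f i| ≤ 2 * s / n * C := fun i hi => by
    have hki : (k : ℝ) ≤ i := by exact_mod_cast (Finset.mem_Ioi.1 hi).le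
    have hwi : w i ≤ 2 * s / n := by
      rw [le_div_iff₀ hn]
      nlinarith [hw.mul_le i, hw.nonneg i]
    rw [abs_mul, abs_of_nonneg (hw.nonneg i)]
    exact mul_le_mul hwi (hf i) (abs_nonneg _) ((hw.nonneg i).trans hwi)
  have hcard : ((Finset.Ioi k).card : ℝ) = (n : ℝ) - 1 - k := by
    rw [Fin.card_Ioi, Nat.cast_sub (by lia), Nat.cast_sub k.pos, Nat.cast_one]
  rw [sum_lowerWeight_mul_col, ← hcard, ← nsmul_eq_mul]
  exact (Finset.abs_sum_le_sum_abs _ _).trans (Finset.sum_le_card_nsmul _ _ _ hterm)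

theorem le_abs_sum_row (hw : IsRowWeight w s L) {k : Fin n} (hk : (n : ℝ) / 2 ≤ k) {f : Fin n → ℝ}
    {d : ℝ} (hd : 0 ≤ d) (hf : (∀ j < k, d ≤ f j) ∨ ∀ j < k, f j ≤ -d) :
    s * d / 2 ≤ |∑ j, lowerWeight w k j * f j| := by
  have hsum : k * d ≤ |∑ j ∈ Finset.Iio k, f j| := by
    have hcard : (k : ℝ) * d = (Finset.Iio k).card • d := by simp
    rcases hf with hf | hf
    · refine le_trans ?_ (le_abs_self _)
      rw [hcard]
      exact Finset.card_nsmul_le_sum _ _ _ fun j hj => hf j (Finset.mem_Iio.1 hj)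
    · refine le_trans ?_ (neg_le_abs _)
      rw [hcard, ← Finset.sum_neg_distrib]
      exact Finset.card_nsmul_le_sum _ _ _ fun j hj => le_neg_of_le_neg (hf j (Finset.mem_Iio.1 hj))
  calc s * d / 2 = s / 2 * d := by ring
    _ ≤ k * w k * d := by gcongr; exact hw.le_mul k hk
    _ = w k * (k * d) := by ring
    _ ≤ w k * |∑ j ∈ Finset.Iio k, f j| := mul_le_mul_of_nonneg_left hsum (hw.nonneg k)
    _ = |∑ j, lowerWeight w k j * f j| := by
        rw [sum_lowerWeight_mul_row, abs_mul, abs_of_nonneg (hw.nonneg k)]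

end IsRowWeight

end LowerWeight

/-! ### The Hájek projection under one-sided deviations -/

section HajekProjection

theorem mul_sq_le_integral_sq {Ω : Type*} [MeasurableSpace Ω] {μ : Measure Ω} [IsFiniteMeasure μ]
    {Y : Ω → ℝ} (hY : MemLp Y 2 μ) {s : Set Ω} {p T : ℝ} (hT : 0 ≤ T) (hs : p ≤ μ.real s)
    (h : ∀ ω ∈ s, T ≤ |Y ω|) :
    p * T ^ 2 ≤ ∫ ω, Y ω ^ 2 ∂μ :=
  calc p * T ^ 2 ≤ μ.real {ω | T ^ 2 ≤ Y ω ^ 2} * T ^ 2 := by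
        gcongr
        refine hs.trans (measureReal_mono fun ω hω => ?_)
        change T ^ 2 ≤ Y ω ^ 2
        exact sq_abs (Y ω) ▸ pow_le_pow_left₀ hT (h ω hω) 2
    _ = T ^ 2 * μ.real {ω | T ^ 2 ≤ Y ω ^ 2} := mul_comm _ _
    _ ≤ ∫ ω, Y ω ^ 2 ∂μ := mul_meas_ge_le_integral_of_nonneg
        (ae_of_all _ fun ω => sq_nonneg _) hY.integrable_sq _

variable {n : ℕ} {w : Fin n → ℝ} {s L : ℝ} {ν : Fin n → Measure ℝ}
  [∀ i, IsProbabilityMeasure (ν i)] {d p : ℝ}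

theorem IsRowWeight.le_abs_hajekTerm (hw : IsRowWeight w s L) (hn : 3 ≤ n) (hd : d ∈ Set.Ioc 0 1)
    {k : Fin n} (hk : (n : ℝ) - 1 - k ≤ d * n / 16) {x : ℝ} (hx : x ∈ oneSidedDeviation ν d k) :
    s * d / 4 ≤ |hajekTerm (lowerWeight w) ltKernel ν k x| := by
  have hn' : (3 : ℝ) ≤ n := by exact_mod_cast hn
  have hk_half : (n : ℝ) / 2 ≤ k := by nlinarith [hd.2]
  have hrow : s * d / 2 ≤ |∑ j, lowerWeight w k j * kernelProj ltKernel (ν k) (ν j) x| :=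
    hw.le_abs_sum_row hk_half hd.1.le hx
  have hcol : |∑ i, lowerWeight w i k * kernelProj (flip ltKernel) (ν k) (ν i) x| ≤ s * d / 4 :=
    calc _ ≤ ((n : ℝ) - 1 - k) * (2 * s / n * (2 * 1)) :=
          hw.abs_sum_col_le hk_half fun _ => isBoundedKernel_ltKernel.flip.abs_kernelProj_le _
      _ ≤ d * n / 16 * (2 * s / n * (2 * 1)) := by
          have := hw.size_nonneg
          gcongr
      _ = s * d / 4 := by field_simp; ring
  have htriangle := abs_sub_abs_le_abs_add
    (∑ j, lowerWeight w k j * kernelProj ltKernel (ν k) (ν j) x)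
    (∑ i, lowerWeight w i k * kernelProj (flip ltKernel) (ν k) (ν i) x)
  rw [hajekTerm]
  linarith

theorem IsRowWeight.le_sum_integral_hajekTerm_sq (hw : IsRowWeight w s L) (hn : 3 ≤ n)
    (hd : d ∈ Set.Ioc 0 1) (hp : 0 ≤ p)
    (hdev : ∀ k, p ≤ (ν k).real (oneSidedDeviation ν d k)) :
    d ^ 3 * p * (s ^ 2 * n) / 256
      ≤ ∑ k, ∫ x, hajekTerm (lowerWeight w) ltKernel ν k x ^ 2 ∂(ν k) := by
  have hn' : (3 : ℝ) ≤ n := by exact_mod_cast hn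
  have hT : 0 ≤ s * d / 4 := div_nonneg (mul_nonneg hw.size_nonneg hd.1.le) (by norm_num)
  calc d ^ 3 * p * (s ^ 2 * n) / 256 = d * n / 16 * (p * (s * d / 4) ^ 2) := by ring
    _ ≤ _ := mul_le_sum_of_le_last (div_nonneg (mul_nonneg hd.1.le n.cast_nonneg) (by norm_num))
        (by nlinarith [hd.2]) (mul_nonneg hp (sq_nonneg _))
        (fun k => integral_nonneg fun x => sq_nonneg _)
        fun k hk => mul_sq_le_integral_sq (memLp_hajekTerm isBoundedKernel_ltKernel k) hT (hdev k)
          fun x hx => hw.le_abs_hajekTerm hn hd hk hx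

theorem IsRowWeight.hajekTerm_sq_le (hw : IsRowWeight w s L) (hL : 1 ≤ L) (k : Fin n) (x : ℝ) :
    hajekTerm (lowerWeight w) ltKernel ν k x ^ 2 ≤ 16 * (s ^ 2 * L ^ 2) := by
  have habs : |hajekTerm (lowerWeight w) ltKernel ν k x| ≤ 4 * (s * L) := by
    nlinarith [abs_hajekTerm_le (b := lowerWeight w) (ν := ν) isBoundedKernel_ltKernel k x,
      hw.sum_abs_lowerWeight_le k, hw.size_nonneg]
  calc hajekTerm (lowerWeight w) ltKernel ν k x ^ 2 ≤ (4 * (s * L)) ^ 2 :=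
        sq_le_sq.2 (habs.trans (le_abs_self _))
    _ = 16 * (s ^ 2 * L ^ 2) := by ring

theorem IsRowWeight.integral_hoeffdingRemainder_sq_le (hw : IsRowWeight w s L) :
    ∫ x, hoeffdingRemainder (lowerWeight w) ltKernel ν x ^ 2 ∂(Measure.pi ν)
      ≤ 36 * (s ^ 2 * L) := by
  have := _root_.integral_hoeffdingRemainder_sq_le (ν := ν) isBoundedKernel_ltKernel
    (lowerWeight_eq_zero_or_eq_zero w)
  linarith [hw.sum_lowerWeight_sq_le]

theorem IsRowWeight.le_variance_pairSum (hw : IsRowWeight w s L) (hn : 3 ≤ n)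
    (hd : d ∈ Set.Ioc 0 1) (hp : 0 ≤ p)
    (hdev : ∀ k, p ≤ (ν k).real (oneSidedDeviation ν d k)) :
    d ^ 3 * p * (s ^ 2 * n) / 256 ≤ Var[pairSum (lowerWeight w) ltKernel; Measure.pi ν] := by
  rw [(isHajekDecomposition_pairSum isBoundedKernel_ltKernel (lowerWeight_self w)).variance_eq]
  simp only [integral_hajekTerm_sq_pi isBoundedKernel_ltKernel]
  exact le_add_of_le_of_nonneg (hw.le_sum_integral_hajekTerm_sq hn hd hp hdev)
    (integral_nonneg fun x => sq_nonneg _)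

end HajekProjection

theorem asymptoticallyNormal_pairSum_lowerWeight {ν : ∀ n, Fin n → Measure ℝ}
    [∀ n i, IsProbabilityMeasure (ν n i)] {δ p s L : ℕ → ℝ} {w : ∀ n, Fin n → ℝ}
    (hδ : ∀ᶠ n in atTop, δ n ∈ Set.Ioc 0 1) (hp : ∀ᶠ n in atTop, 0 < p n)
    (hdev : ∀ᶠ n in atTop, ∀ k, p n ≤ (ν n k).real (oneSidedDeviation (ν n) (δ n) k))
    (hw : ∀ᶠ n in atTop, IsRowWeight (w n) (s n) (L n)) (hs : ∀ᶠ n in atTop, 0 < s n)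
    (hL : ∀ᶠ n in atTop, 1 ≤ L n)
    (hrate : (fun n : ℕ => L n ^ 2 / n) =o[atTop] fun n => δ n ^ 3 * p n) :
    AsymptoticallyNormal (fun n => Measure.pi (ν n))
      fun n => pairSum (lowerWeight (w n)) ltKernel := by
  have hr : Tendsto (fun n : ℕ => 9216 * (L n ^ 2 / n / (δ n ^ 3 * p n))) atTop (𝓝 0) := by
    simpa using hrate.tendsto_div_nhds_zero.const_mul 9216
  have hvar : ∀ᶠ n in atTop, 0 < Var[pairSum (lowerWeight (w n)) ltKernel; Measure.pi (ν n)] ∧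
      36 * (s n ^ 2 * L n ^ 2) ≤ 9216 * (L n ^ 2 / n / (δ n ^ 3 * p n))
        * Var[pairSum (lowerWeight (w n)) ltKernel; Measure.pi (ν n)] := by
    filter_upwards [hδ, hp, hdev, hw, hs, eventually_ge_atTop 3] with n hδn hpn hdevn hwn hsn hn
    have hδ0 := hδn.1
    have : (0 : ℝ) < n := by exact_mod_cast (by lia : 0 < n)
    have hle := hwn.le_variance_pairSum hn hδn hpn.le hdevn
    refine ⟨lt_of_lt_of_le (by positivity) hle, ?_⟩
    calc 36 * (s n ^ 2 * L n ^ 2) = 9216 * (L n ^ 2 / n / (δ n ^ 3 * p n))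
          * (δ n ^ 3 * p n * (s n ^ 2 * n) / 256) := by field_simp; ring
      _ ≤ _ := by gcongr
  refine asymptoticallyNormal_of_isHajekDecomposition (fun n =>
    isHajekDecomposition_pairSum isBoundedKernel_ltKernel (lowerWeight_self (w n))) hr
    (hvar.mono fun n h => h.1) ?_ ?_
  · filter_upwards [hvar, hw, hL] with n hvarn hwn hLn k
    refine ae_of_all _ fun x => (hwn.hajekTerm_sq_le hLn k _).trans (le_trans ?_ hvarn.2)
    gcongr
    norm_num
  · filter_upwards [hvar, hw, hL] with n hvarn hwn hLn
    refine hwn.integral_hoeffdingRemainder_sq_le.trans (le_trans ?_ hvarn.2)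
    gcongr
    exact le_self_pow₀ hLn two_ne_zero

/-! ### Kendall's tau and average-precision correlation -/

section RowWeight

variable {n : ℕ}

theorem IsRowWeight.const_mul {w : Fin n → ℝ} {s L c : ℝ} (hw : IsRowWeight w s L) (hc : 0 ≤ c) :
    IsRowWeight (fun i => c * w i) (c * s) L where
  size_nonneg := mul_nonneg hc hw.size_nonneg
  nonneg i := mul_nonneg hc (hw.nonneg i)
  mul_le i := by nlinarith [hw.mul_le i]
  le_mul i hi := by nlinarith [hw.le_mul i hi]
  sum_le := by
    rw [← Finset.mul_sum, mul_assoc]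
    exact mul_le_mul_of_nonneg_left hw.sum_le hc

theorem isRowWeight_one (n : ℕ) : IsRowWeight (fun _ : Fin n => 1) n 1 where
  size_nonneg := n.cast_nonneg
  nonneg _ := zero_le_one
  mul_le i := by simp
  le_mul i hi := by rwa [mul_one]
  sum_le := by simp

theorem sum_natCast_div_le (n : ℕ) : ∑ i : Fin n, (n : ℝ) / i ≤ n * (1 + Real.log n) :=
  calc ∑ i : Fin n, (n : ℝ) / i = n * ∑ i ∈ Finset.range n, (i : ℝ)⁻¹ := by
        simp only [div_eq_mul_inv, ← Finset.mul_sum,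
          Fin.sum_univ_eq_sum_range fun i : ℕ => (i : ℝ)⁻¹]
    _ ≤ n * ∑ i ∈ Finset.range (n + 1), (i : ℝ)⁻¹ := by
        gcongr
        exact n.le_succ
    _ = n * harmonic n := by simp [Finset.sum_range_succ', harmonic]
    _ ≤ n * (1 + Real.log n) := by
        gcongr
        exact harmonic_le_one_add_log n

theorem isRowWeight_natCast_div (n : ℕ) :
    IsRowWeight (fun i : Fin n => (n : ℝ) / i) n (1 + Real.log n) where
  size_nonneg := n.cast_nonneg
  nonneg _ := by positivity
  mul_le i := by
    rw [mul_div_left_comm]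
    exact mul_le_of_le_one_right n.cast_nonneg (div_self_le_one _)
  le_mul i hi := by
    have hn : (0 : ℝ) < n := by exact_mod_cast i.pos
    rw [mul_div_cancel₀ _ (by linarith)]
    linarith
  sum_le := sum_natCast_div_le n

theorem weightedRankStat_ite_lt (u x : Fin n → ℝ) :
    weightedRankStat (fun i j => if j < i then u i else 0) x
      = pairSum (lowerWeight fun i => 1 / ((n : ℝ) * (n - 1)) * u i) ltKernel x := by
  unfold weightedRankStat pairSum lowerWeight ltKernel
  simp only [Finset.mul_sum]
  refine Finset.sum_congr rfl fun i _ => Finset.sum_congr rfl fun j _ => ?_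
  by_cases hji : j < i
  · simp [hji, hji.ne]
  · simp [hji]

end RowWeight

theorem asymptoticallyNormal_weightedRankStat {Ω : ℕ → Type*} [∀ n, MeasurableSpace (Ω n)]
    {μ : ∀ n, Measure (Ω n)} [∀ n, IsProbabilityMeasure (μ n)] {X : ∀ n, Fin n → Ω n → ℝ}
    (hX_meas : ∀ n i, Measurable (X n i)) (hX_indep : ∀ n, iIndepFun (X n) (μ n))
    {δ p L : ℕ → ℝ} {u : ∀ n, Fin n → ℝ}
    (hδ : ∀ᶠ n in atTop, δ n ∈ Set.Ioc 0 1) (hp : ∀ᶠ n in atTop, 0 < p n)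
    (hdev : ∀ᶠ n in atTop, ∀ i : Fin n,
      p n ≤ (μ n).real {ω | ∀ j < i, δ n ≤ centeredCondProb (μ n) (X n) i j ω} ∨
      p n ≤ (μ n).real {ω | ∀ j < i, centeredCondProb (μ n) (X n) i j ω ≤ -δ n})
    (hu : ∀ n, IsRowWeight (u n) n (L n)) (hL : ∀ᶠ n in atTop, 1 ≤ L n)
    (hrate : (fun n : ℕ => L n ^ 2 / n) =o[atTop] fun n => δ n ^ 3 * p n) :
    AsymptoticallyNormal μ fun n ω =>
      weightedRankStat (fun i j => if j < i then u n i else 0) fun i => X n i ω := by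
  have (n : ℕ) (i : Fin n) : IsProbabilityMeasure ((μ n).map (X n i)) :=
    Measure.isProbabilityMeasure_map (hX_meas n i).aemeasurable
  have hc : ∀ᶠ n : ℕ in atTop, (0 : ℝ) < 1 / (n * (n - 1)) := by
    filter_upwards [eventually_gt_atTop 1] with n hn
    have hn' : (1 : ℝ) < n := by exact_mod_cast hn
    exact one_div_pos.2 (mul_pos (by linarith) (by linarith))
  have hpi := asymptoticallyNormal_pairSum_lowerWeight (ν := fun n i => (μ n).map (X n i)) hδ hp
    (hdev.mono fun n h k => le_measureReal_oneSidedDeviation (hX_meas n) (hX_indep n) (h k))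
    (hc.mono fun n h => (hu n).const_mul h.le)
    ((hc.and (eventually_gt_atTop 0)).mono fun n h => mul_pos h.1 (Nat.cast_pos.2 h.2)) hL hrate
  simp only [weightedRankStat_ite_lt]
  exact hpi.comp_measurePreserving (fun n => measurable_pairSum _ isBoundedKernel_ltKernel)
    fun n => measurePreserving_pi_of_iIndepFun (hX_meas n) (hX_indep n)

theorem eventually_one_le_log_natCast : ∀ᶠ n : ℕ in atTop, 1 ≤ Real.log n :=
  (Real.tendsto_log_atTop.comp tendsto_natCast_atTop_atTop).eventually_ge_atTop 1

theorem isBigO_one_add_log_sq_div :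
    (fun n : ℕ => (1 + Real.log n) ^ 2 / n) =O[atTop] fun n => (n : ℝ)⁻¹ * Real.log n ^ 2 := by
  refine .of_bound 4 ?_
  filter_upwards [eventually_one_le_log_natCast] with n hn
  rw [Real.norm_of_nonneg (by positivity), Real.norm_of_nonneg (by positivity)]
  calc (1 + Real.log n) ^ 2 / n ≤ (2 * Real.log n) ^ 2 / n := by gcongr; linarith
    _ = 4 * ((n : ℝ)⁻¹ * Real.log n ^ 2) := by ring

theorem isLittleO_natCast_inv_rpow {b : ℝ} (hb : -1 < b) :
    (fun n : ℕ => (n : ℝ)⁻¹) =o[atTop] fun n => (n : ℝ) ^ b := by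
  have hpow : Tendsto (fun n : ℕ => (n : ℝ) ^ (-(1 + b))) atTop (𝓝 0) :=
    (tendsto_rpow_neg_atTop (by linarith)).comp tendsto_natCast_atTop_atTop
  refine (isLittleO_iff_tendsto' ?_).2 (hpow.congr' ?_) <;>
    filter_upwards [eventually_gt_atTop 0] with n hn
  · exact fun h => absurd h (Real.rpow_pos_of_pos (Nat.cast_pos.2 hn) b).ne'
  · rw [neg_add, ← sub_eq_add_neg, Real.rpow_sub (Nat.cast_pos.2 hn), Real.rpow_neg_one]

theorem isLittleO_of_strictlyGtrsim_rpow_mul {a f : ℕ → ℝ} {b : ℝ} (hb : -1 < b)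
    (h : StrictlyGtrsim a fun n => (n : ℝ) ^ b * f n) :
    (fun n : ℕ => (n : ℝ)⁻¹ * f n) =o[atTop] a :=
  ((isLittleO_natCast_inv_rpow hb).mul_isBigO (isBigO_refl f atTop)).trans_isBigO h.1

theorem le_measureReal_centeredCondProb_of_mem_Icc {Ω : Type*} [MeasurableSpace Ω] {μ : Measure Ω}
    [IsFiniteMeasure μ] {n : ℕ} {X : Fin n → Ω → ℝ} {i : Fin n} {d p : ℝ}
    (h : p ≤ μ.real {ω | ∀ j, j ≠ i → centeredCondProb μ X i j ω ∈ Set.Icc d 1} ∨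
      p ≤ μ.real {ω | ∀ j, j ≠ i → centeredCondProb μ X i j ω ∈ Set.Icc (-1) (-d)}) :
    p ≤ μ.real {ω | ∀ j < i, d ≤ centeredCondProb μ X i j ω} ∨
      p ≤ μ.real {ω | ∀ j < i, centeredCondProb μ X i j ω ≤ -d} :=
  h.imp (fun hle => hle.trans (measureReal_mono fun _ hω j hj => (hω j hj.ne).1))
    fun hle => hle.trans (measureReal_mono fun _ hω j hj => (hω j hj.ne).2)

theorem mainTheorem6_general {Ω : ℕ → Type*} [∀ n, MeasurableSpace (Ω n)]
    (μ : ∀ n, Measure (Ω n)) [∀ n, IsProbabilityMeasure (μ n)]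
    (X : ∀ n, Fin n → Ω n → ℝ)
    (hX_meas : ∀ n i, Measurable (X n i))
    (hX_indep : ∀ n, iIndepFun (X n) (μ n))
    (δ p : ℕ → ℝ)
    (hδ : ∀ᶠ n in atTop, δ n ∈ Set.Ioc (0 : ℝ) 1)
    (hp : ∀ᶠ n in atTop, 0 < p n)
    (hdev : ∀ᶠ n in atTop, ∀ i : Fin n,
      p n ≤ (μ n).real {ω | ∀ j < i, δ n ≤ centeredCondProb (μ n) (X n) i j ω} ∨
      p n ≤ (μ n).real {ω | ∀ j < i, centeredCondProb (μ n) (X n) i j ω ≤ -δ n}) :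
    ((fun n : ℕ => (n : ℝ)⁻¹) =o[atTop] (fun n => δ n ^ 3 * p n) →
      AsymptoticallyNormal μ (fun n ω => kendallU (fun i => X n i ω))) ∧
    ((fun n : ℕ => (n : ℝ)⁻¹ * Real.log n ^ 2) =o[atTop] (fun n => δ n ^ 3 * p n) →
      AsymptoticallyNormal μ (fun n ω => apU (fun i => X n i ω))) :=
  ⟨fun hrate => asymptoticallyNormal_weightedRankStat hX_meas hX_indep hδ hp hdev isRowWeight_one
      (.of_forall fun _ => le_rfl) (by simpa using hrate),
    fun hrate => asymptoticallyNormal_weightedRankStat hX_meas hX_indep hδ hp hdev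
      isRowWeight_natCast_div (eventually_one_le_log_natCast.mono fun n h => by linarith)
      (isBigO_one_add_log_sq_div.trans_isLittleO hrate)⟩

theorem mainTheorem6 {Ω : ℕ → Type*} [∀ n, MeasurableSpace (Ω n)]
    (μ : ∀ n, Measure (Ω n)) [∀ n, IsProbabilityMeasure (μ n)]
    (X : ∀ n, Fin n → Ω n → ℝ)
    (hX_meas : ∀ n i, Measurable (X n i))
    (hX_indep : ∀ n, iIndepFun (X n) (μ n))
    (hX_ac : ∀ n i, (μ n).map (X n i) ≪ volume)
    (δ p : ℕ → ℝ)
    (hδ : ∀ n, 1 ≤ n → δ n ∈ Set.Ioo (0 : ℝ) 1)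
    (hp : ∀ n, 1 ≤ n → p n ∈ Set.Ioo (0 : ℝ) 1)
    (hdev : ∀ᶠ n in atTop, ∀ i : Fin n,
      p n ≤ (μ n).real
          {ω | ∀ j, j ≠ i → centeredCondProb (μ n) (X n) i j ω ∈ Set.Icc (δ n) 1} ∨
      p n ≤ (μ n).real
          {ω | ∀ j, j ≠ i → centeredCondProb (μ n) (X n) i j ω ∈ Set.Icc (-1) (-δ n)}) :
    (StrictlyGtrsim (fun n => δ n ^ 3 * p n) (fun n => (n : ℝ) ^ (-(1 / 3) : ℝ)) →
      AsymptoticallyNormal μ (fun n ω => kendallU (fun i => X n i ω))) ∧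
    (StrictlyGtrsim (fun n => δ n ^ 3 * p n)
        (fun n => (n : ℝ) ^ (-(1 / 3) : ℝ) * Real.log n ^ 2) →
      AsymptoticallyNormal μ (fun n ω => apU (fun i => X n i ω))) := by
  obtain ⟨hKen, hAP⟩ := mainTheorem6_general μ X hX_meas hX_indep δ p
    ((eventually_ge_atTop 1).mono fun n hn => Set.Ioo_subset_Ioc_self (hδ n hn))
    ((eventually_ge_atTop 1).mono fun n hn => (hp n hn).1)
    (hdev.mono fun n h i => le_measureReal_centeredCondProb_of_mem_Icc (h i))
  have hexp : (-1 : ℝ) < -(1 / 3) := by norm_num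
  exact ⟨fun h => hKen ((isLittleO_natCast_inv_rpow hexp).trans_isBigO h.1),
    fun h => hAP (isLittleO_of_strictlyGtrsim_rpow_mul hexp h)⟩
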